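/- Let $(M,g)$ be a connected smooth Lorentzian manifold (Hausdorff, second countable, without boundary), and let $\mathfrak{k}$ be its Killing algebra, i.e. the Lie algebra, under the Lie bracket of vector fields, of all smooth vector fields $K$ on $M$ with $L_K g = 0$. Let $\mathfrak{r}$ be the radical of $\mathfrak{k}$ (its largest solvable ideal, so that $\mathfrak{k}=\mathfrak{s}\ltimes\mathfrak{r}$ with $\mathfrak{s}$ semisimple is the Levi decomposition). Let $\mathcal{H}\subset M$ be a nonempty, injectively immersed (for example embedded) smooth hypersurface that is null, i.e. $g|_{T_a\mathcal{H}}$ is degenerate for every $a\in\mathcal{H}$. Suppose that $\mathcal{H}$ is a Killing horizon, i.e. there is $K\in\mathfrak{k}$ with $g(K,K)|_{\mathcal{H}}=0$ and $K_a\in T_a\mathcal{H}\setminus\{0\}$ for every $a\in\mathcal{H}$, and that $\mathcal{H}$ is $\mathfrak{k}$-invariant, i.e. $X_a\in T_a\mathcal{H}$ for all $X\in\mathfrak{k}$ and $a\in\mathcal{H}$. Call $K\in\mathfrak{k}$ a generator of $\mathcal{H}$ if $g(K,K)|_{\mathcal{H}}=0$ and $K_a\in T_a\mathcal{H}\setminus\{0\}$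 for all $a$ in an open dense subset of $\mathcal{H}$, and let $\mathfrak{a}_{\mathcal{H}}\subset\mathfrak{k}$ be the set consisting of all generators of $\mathcal{H}$ and the zero vector field. Then $\mathfrak{a}_{\mathcal{H}}$ is an ideal of $\mathfrak{k}$ and $\mathfrak{a}_{\mathcal{H}}\subseteq\mathfrak{r}$. In particular, $\mathfrak{r}\neq\{0\}$. -/

import Mathlib

open Set Function Bundle VectorField Filter
open scoped Manifold ContDiff Topology

noncomputable section

/-! ### The Lie algebra of smooth vector fields on a manifold -/

section VectorFields

variable (d : ℕ) (M : Type*) [TopologicalSpace M] [ChartedSpace (EuclideanSpace ℝ (Fin d)) M]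
  [IsManifold (𝓡 d) ∞ M]

/-- Smooth vector fields on a smooth `d`-dimensional manifold `M` (without boundary). -/
abbrev SmoothVectorField : Type _ :=
  ContMDiffSection (𝓡 d) (EuclideanSpace ℝ (Fin d)) ∞ (TangentSpace (𝓡 d) : M → Type _)

variable {d M}

theorem isManifold_minSmoothness (k : ℕ) : IsManifold (𝓡 d) (minSmoothness ℝ k) M :=
  IsManifold.of_le (n := ∞) (by simpa using mod_cast le_top)

/-- On an open set, the Lie bracket of smooth vector fields is smooth. -/
theorem contMDiffOn_mlieBracket {U : Set M} (hU : IsOpen U)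
    {X Y : ∀ x : M, TangentSpace (𝓡 d) x}
    (hX : ContMDiffOn (𝓡 d) (𝓡 d).tangent ∞ (fun x ↦ (⟨x, X x⟩ : TangentBundle (𝓡 d) M)) U)
    (hY : ContMDiffOn (𝓡 d) (𝓡 d).tangent ∞ (fun x ↦ (⟨x, Y x⟩ : TangentBundle (𝓡 d) M)) U) :
    ContMDiffOn (𝓡 d) (𝓡 d).tangent ∞
      (fun x ↦ (⟨x, mlieBracket (𝓡 d) X Y x⟩ : TangentBundle (𝓡 d) M)) U := by
  have := isManifold_minSmoothness (d := d) (M := M) 2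
  have : IsManifold (𝓡 d) (((⊤ : ℕ∞) : WithTop ℕ∞) + 1) M := by
    simpa using (inferInstance : IsManifold (𝓡 d) ∞ M)
  intro x hx
  exact (ContMDiffAt.mlieBracket_vectorField (m := ⊤) (n := ⊤)
    (hX.contMDiffAt (hU.mem_nhds hx)) (hY.contMDiffAt (hU.mem_nhds hx))
    (by simp)).contMDiffWithinAt

/-- The Lie bracket of smooth vector fields. -/
instance SmoothVectorField.instBracket :
    Bracket (SmoothVectorField d M) (SmoothVectorField d M) where
  bracket X Y :=
    { toFun := mlieBracket (𝓡 d) X Y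
      contMDiff_toFun := contMDiffOn_univ.1 (contMDiffOn_mlieBracket isOpen_univ
        X.contMDiff.contMDiffOn Y.contMDiff.contMDiffOn) }

theorem SmoothVectorField.lie_apply (X Y : SmoothVectorField d M) (x : M) :
    ⁅X, Y⁆ x = mlieBracket (𝓡 d) X Y x := rfl

instance SmoothVectorField.instLieRing : LieRing (SmoothVectorField d M) where
  add_lie X Y Z := by
    ext x
    exact mlieBracket_add_left (W := Z) X.mdifferentiableAt Y.mdifferentiableAt
  lie_add X Y Z := by
    ext x
    exact mlieBracket_add_right (V := X) Y.mdifferentiableAt Z.mdifferentiableAt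
  lie_self X := by
    ext x
    simp [SmoothVectorField.lie_apply]
  leibniz_lie X Y Z := by
    ext x
    have := isManifold_minSmoothness (d := d) (M := M) 3
    have h2 : minSmoothness ℝ 2 ≤ ∞ := by
      rw [minSmoothness_of_isRCLikeNormedField]
      exact WithTop.coe_le_coe.2 (le_top : (2 : ℕ∞) ≤ ⊤)
    exact leibniz_identity_mlieBracket_apply (X.contMDiff.of_le h2 x)
      (Y.contMDiff.of_le h2 x) (Z.contMDiff.of_le h2 x)

instance SmoothVectorField.instLieAlgebra : LieAlgebra ℝ (SmoothVectorField d M) where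
  lie_smul c X Y := by
    ext x
    exact mlieBracket_const_smul_right (V := X) Y.mdifferentiableAt

theorem mvfderiv_apply_congr {f f' : M → ℝ} {x : M} (h : f =ᶠ[𝓝 x] f')
    (v : TangentSpace (𝓡 d) x) : mvfderiv (𝓡 d) f x v = mvfderiv (𝓡 d) f' x v := by
  have e : (mfderiv (𝓡 d) 𝓘(ℝ, ℝ) f x : TangentSpace (𝓡 d) x →L[ℝ] ℝ) =
    mfderiv (𝓡 d) 𝓘(ℝ, ℝ) f' x := h.mfderiv_eq
  exact DFunLike.congr_fun e v

/-- The Lie bracket with `h Z`, differentiated once more. -/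
theorem mlieBracket_mlieBracket_smul (X Y Z : SmoothVectorField d M) {h : M → ℝ} {x : M}
    (hh : ∀ᶠ y in 𝓝 x, MDifferentiableAt (𝓡 d) 𝓘(ℝ, ℝ) h y)
    (hYh : MDifferentiableAt (𝓡 d) 𝓘(ℝ, ℝ) (fun y ↦ mvfderiv (𝓡 d) h y (Y y)) x) :
    mlieBracket (𝓡 d) X (mlieBracket (𝓡 d) Y (h • ⇑Z)) x =
      mvfderiv (𝓡 d) (fun y ↦ mvfderiv (𝓡 d) h y (Y y)) x (X x) • Z x
      + mvfderiv (𝓡 d) h x (Y x) • mlieBracket (𝓡 d) X Z x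
      + (mvfderiv (𝓡 d) h x (X x) • mlieBracket (𝓡 d) Y Z x
      + h x • mlieBracket (𝓡 d) X (mlieBracket (𝓡 d) Y Z) x) := by
  have e : mlieBracket (𝓡 d) Y (h • ⇑Z) =ᶠ[𝓝 x]
      (((fun y ↦ mvfderiv (𝓡 d) h y (Y y)) • ⇑Z) + (h • ⇑⁅Y, Z⁆)) := by
    filter_upwards [hh] with y hy
    exact mlieBracket_smul_right hy Z.mdifferentiableAt
  have e' := EventuallyEq.mlieBracket_vectorField_eq (EventuallyEq.refl (𝓝 x) ⇑X) e
  refine e'.trans ?_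
  rw [mlieBracket_add_right (hYh.smul_section Z.mdifferentiableAt)
      (hh.self_of_nhds.smul_section ⁅Y, Z⁆.mdifferentiableAt),
    mlieBracket_smul_right hYh Z.mdifferentiableAt,
    mlieBracket_smul_right hh.self_of_nhds ⁅Y, Z⁆.mdifferentiableAt]
  rfl

/-- `[X, Y] h = X (Y h) - Y (X h)`. -/
theorem mvfderiv_mlieBracket (X Y : SmoothVectorField d M) {h : M → ℝ} {x : M}
    (hh₂ : ContMDiffAt (𝓡 d) 𝓘(ℝ, ℝ) ∞ h x)
    (hh : ∀ᶠ y in 𝓝 x, MDifferentiableAt (𝓡 d) 𝓘(ℝ, ℝ) h y)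
    (hXh : MDifferentiableAt (𝓡 d) 𝓘(ℝ, ℝ) (fun y ↦ mvfderiv (𝓡 d) h y (X y)) x)
    (hYh : MDifferentiableAt (𝓡 d) 𝓘(ℝ, ℝ) (fun y ↦ mvfderiv (𝓡 d) h y (Y y)) x) :
    mvfderiv (𝓡 d) h x (mlieBracket (𝓡 d) X Y x) =
      mvfderiv (𝓡 d) (fun y ↦ mvfderiv (𝓡 d) h y (Y y)) x (X x) -
        mvfderiv (𝓡 d) (fun y ↦ mvfderiv (𝓡 d) h y (X y)) x (Y x) := by
  -- If `Z x ≠ 0`, compare the coefficients of `Z` in the Jacobi identity for `X`, `Y`, `h Z`.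
  have key : ∀ Z : SmoothVectorField d M,
      (mvfderiv (𝓡 d) h x (mlieBracket (𝓡 d) X Y x)) • Z x =
      (mvfderiv (𝓡 d) (fun y ↦ mvfderiv (𝓡 d) h y (Y y)) x (X x) -
        mvfderiv (𝓡 d) (fun y ↦ mvfderiv (𝓡 d) h y (X y)) x (Y x)) • Z x := by
    intro Z
    have := isManifold_minSmoothness (d := d) (M := M) 3
    have h2 : minSmoothness ℝ 2 ≤ ∞ := by
      rw [minSmoothness_of_isRCLikeNormedField]
      exact WithTop.coe_le_coe.2 (le_top : (2 : ℕ∞) ≤ ⊤)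
    have J := leibniz_identity_mlieBracket_apply (U := X) (V := Y) (W := h • ⇑Z)
      (X.contMDiff.of_le h2 x) (Y.contMDiff.of_le h2 x)
      ((hh₂.smul_section (Z.contMDiff x)).of_le h2)
    have J' := leibniz_identity_mlieBracket_apply (U := X) (V := Y) (W := Z)
      (X.contMDiff.of_le h2 x) (Y.contMDiff.of_le h2 x) (Z.contMDiff.of_le h2 x)
    rw [mlieBracket_mlieBracket_smul X Y Z hh hYh, mlieBracket_mlieBracket_smul Y X Z hh hXh,
      mlieBracket_smul_right hh.self_of_nhds Z.mdifferentiableAt, J', smul_add] at J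
    rw [sub_smul, eq_sub_iff_add_eq]
    have J2 := sub_eq_zero.2 J
    rw [← sub_eq_zero, ← neg_eq_zero, ← J2]
    abel
  by_cases hX : X x = 0
  · by_cases hY : Y x = 0
    · have h0 : mlieBracket (𝓡 d) X Y x = 0 := by
        rw [← mlieBracketWithin_univ]
        exact mlieBracketWithin_eq_zero_of_eq_zero hX hY
      rw [h0, hX, hY]
      simp
    · exact smul_left_injective ℝ hY (key Y)
  · exact smul_left_injective ℝ hX (key X)

end VectorFields

/-! ### Lorentzian metrics and Killing vector fields -/

section Lorentzian

variable {d : ℕ} {M : Type*} [TopologicalSpace M] [ChartedSpace (EuclideanSpace ℝ (Fin d)) M]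
  [IsManifold (𝓡 d) ∞ M]

variable (d M) in
/-- A smooth Lorentzian metric, of signature `(-, +, …, +)`: in each tangent space there is
a vector `v` with `g(v, v) < 0` whose orthogonal complement is positive definite. -/
structure LorentzianMetric where
  /-- The symmetric bilinear form on each tangent space. -/
  form (x : M) : TangentSpace (𝓡 d) x →L[ℝ] TangentSpace (𝓡 d) x →L[ℝ] ℝ
  symm (x : M) (v w : TangentSpace (𝓡 d) x) : form x v w = form x w v
  lorentzian (x : M) : ∃ v : TangentSpace (𝓡 d) x, form x v v < 0 ∧
    ∀ w : TangentSpace (𝓡 d) x, w ≠ 0 → form x v w = 0 → 0 < form x w w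
  contMDiff : ContMDiff (𝓡 d)
    ((𝓡 d).prod 𝓘(ℝ, EuclideanSpace ℝ (Fin d) →L[ℝ] EuclideanSpace ℝ (Fin d) →L[ℝ] ℝ)) ∞
    (fun x ↦ TotalSpace.mk' (EuclideanSpace ℝ (Fin d) →L[ℝ] EuclideanSpace ℝ (Fin d) →L[ℝ] ℝ)
      (E := fun x : M ↦ TangentSpace (𝓡 d) x →L[ℝ] TangentSpace (𝓡 d) x →L[ℝ] ℝ) x (form x))

namespace LorentzianMetric

variable (g : LorentzianMetric d M)

/-- `K` is a Killing vector field, `L_K g = 0`: for all smooth vector fields `Y`, `Z` defined on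
an open set `U`, one has `K (g(Y, Z)) = g([K, Y], Z) + g(Y, [K, Z])` on `U`. -/
def IsKilling (K : SmoothVectorField d M) : Prop :=
  ∀ (U : Set M), IsOpen U → ∀ Y Z : (∀ x : M, TangentSpace (𝓡 d) x),
    ContMDiffOn (𝓡 d) (𝓡 d).tangent ∞ (fun x ↦ (⟨x, Y x⟩ : TangentBundle (𝓡 d) M)) U →
    ContMDiffOn (𝓡 d) (𝓡 d).tangent ∞ (fun x ↦ (⟨x, Z x⟩ : TangentBundle (𝓡 d) M)) U →
    ∀ x ∈ U, mvfderiv (𝓡 d) (fun y ↦ g.form y (Y y) (Z y)) x (K x) =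
      g.form x (mlieBracket (𝓡 d) K Y x) (Z x) + g.form x (Y x) (mlieBracket (𝓡 d) K Z x)

theorem contMDiffOn_form {U : Set M} {Y Z : ∀ x : M, TangentSpace (𝓡 d) x}
    (hY : ContMDiffOn (𝓡 d) (𝓡 d).tangent ∞ (fun x ↦ (⟨x, Y x⟩ : TangentBundle (𝓡 d) M)) U)
    (hZ : ContMDiffOn (𝓡 d) (𝓡 d).tangent ∞ (fun x ↦ (⟨x, Z x⟩ : TangentBundle (𝓡 d) M)) U) :
    ContMDiffOn (𝓡 d) 𝓘(ℝ, ℝ) ∞ (fun y ↦ g.form y (Y y) (Z y)) U := by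
  have : ContMDiffOn (𝓡 d) ((𝓡 d).prod 𝓘(ℝ, ℝ)) ∞
      (fun m ↦ TotalSpace.mk' ℝ (E := Bundle.Trivial M ℝ) m (g.form m (Y m) (Z m))) U :=
    ContMDiffOn.clm_bundle_apply₂ (F₁ := EuclideanSpace ℝ (Fin d))
      (F₂ := EuclideanSpace ℝ (Fin d)) g.contMDiff.contMDiffOn hY hZ
  intro x hx
  exact (contMDiffWithinAt_totalSpace.1 (this x hx)).2

/-- The Killing algebra: the Lie algebra of all (globally defined, smooth) Killing vector
fields. -/
def killingAlgebra : LieSubalgebra ℝ (SmoothVectorField d M) where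
  carrier := {K | g.IsKilling K}
  zero_mem' := by
    intro U hU Y Z hY hZ x hx
    simp
  add_mem' := by
    intro K L hK hL U hU Y Z hY hZ x hx
    have h1 := hK U hU Y Z hY hZ x hx
    have h2 := hL U hU Y Z hY hZ x hx
    have e1 : mlieBracket (𝓡 d) (⇑(K + L)) Y x = _ :=
      mlieBracket_add_left (W := Y) (K.mdifferentiableAt (x := x)) L.mdifferentiableAt
    have e2 : mlieBracket (𝓡 d) (⇑(K + L)) Z x = _ :=
      mlieBracket_add_left (W := Z) (K.mdifferentiableAt (x := x)) L.mdifferentiableAt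
    rw [e1, e2]
    simp only [ContMDiffSection.coe_add, Pi.add_apply, map_add, add_apply,
      h1, h2]
    ring
  smul_mem' := by
    intro c K hK U hU Y Z hY hZ x hx
    have h1 := hK U hU Y Z hY hZ x hx
    have e1 : mlieBracket (𝓡 d) (⇑(c • K)) Y x = _ :=
      mlieBracket_const_smul_left (W := Y) (K.mdifferentiableAt (x := x))
    have e2 : mlieBracket (𝓡 d) (⇑(c • K)) Z x = _ :=
      mlieBracket_const_smul_left (W := Z) (K.mdifferentiableAt (x := x))
    rw [e1, e2]
    simp only [ContMDiffSection.coe_smul, Pi.smul_apply, map_smul, smul_apply,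
      h1, smul_eq_mul]
    ring
  lie_mem' := by
    intro K L hK hL U hU Y Z hY hZ x hx
    have hUx : U ∈ 𝓝 x := hU.mem_nhds hx
    have sK : ∀ {W : ∀ x : M, TangentSpace (𝓡 d) x},
        ContMDiffOn (𝓡 d) (𝓡 d).tangent ∞ (fun x ↦ (⟨x, W x⟩ : TangentBundle (𝓡 d) M)) U → _ :=
      fun hW ↦ contMDiffOn_mlieBracket hU K.contMDiff.contMDiffOn hW
    have sL : ∀ {W : ∀ x : M, TangentSpace (𝓡 d) x},
        ContMDiffOn (𝓡 d) (𝓡 d).tangent ∞ (fun x ↦ (⟨x, W x⟩ : TangentBundle (𝓡 d) M)) U → _ :=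
      fun hW ↦ contMDiffOn_mlieBracket hU L.contMDiff.contMDiffOn hW
    have sm : ∀ {f : M → ℝ}, ContMDiffOn (𝓡 d) 𝓘(ℝ, ℝ) ∞ f U → ∀ y ∈ U,
        MDifferentiableAt (𝓡 d) 𝓘(ℝ, ℝ) f y :=
      fun hf y hy ↦ (hf.contMDiffAt (hU.mem_nhds hy)).mdifferentiableAt (by simp)
    have eK := eventually_of_mem hUx (hK U hU Y Z hY hZ)
    have eL := eventually_of_mem hUx (hL U hU Y Z hY hZ)
    have dK1 := sm (g.contMDiffOn_form (sK hY) hZ) x hx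
    have dK2 := sm (g.contMDiffOn_form hY (sK hZ)) x hx
    have dL1 := sm (g.contMDiffOn_form (sL hY) hZ) x hx
    have dL2 := sm (g.contMDiffOn_form hY (sL hZ)) x hx
    have main := mvfderiv_mlieBracket K L (h := fun y ↦ g.form y (Y y) (Z y)) (x := x)
      ((g.contMDiffOn_form hY hZ).contMDiffAt hUx) (eventually_of_mem hUx (sm (g.contMDiffOn_form hY hZ)))
      ((dK1.add dK2).congr_of_eventuallyEq eK) ((dL1.add dL2).congr_of_eventuallyEq eL)
    rw [mvfderiv_apply_congr eK, mvfderiv_apply_congr eL] at main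
    have a1 : mvfderiv (𝓡 d) (fun y ↦ g.form y (mlieBracket (𝓡 d) L Y y) (Z y)
        + g.form y (Y y) (mlieBracket (𝓡 d) L Z y)) x = _ := mvfderiv_add dL1 dL2
    have a2 : mvfderiv (𝓡 d) (fun y ↦ g.form y (mlieBracket (𝓡 d) K Y y) (Z y)
        + g.form y (Y y) (mlieBracket (𝓡 d) K Z y)) x = _ := mvfderiv_add dK1 dK2
    rw [a1, a2, add_apply, add_apply, hK U hU _ _ (sL hY) hZ x hx, hK U hU _ _ hY (sL hZ) x hx,
      hL U hU _ _ (sK hY) hZ x hx, hL U hU _ _ hY (sK hZ) x hx] at main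
    have := isManifold_minSmoothness (d := d) (M := M) 3
    have h2 : minSmoothness ℝ 2 ≤ ∞ := by
      rw [minSmoothness_of_isRCLikeNormedField]
      exact WithTop.coe_le_coe.2 (le_top : (2 : ℕ∞) ≤ ⊤)
    have jY := leibniz_identity_mlieBracket_apply (K.contMDiff.of_le h2 x)
      (L.contMDiff.of_le h2 x) ((hY.contMDiffAt hUx).of_le h2)
    have jZ := leibniz_identity_mlieBracket_apply (K.contMDiff.of_le h2 x)
      (L.contMDiff.of_le h2 x) ((hZ.contMDiffAt hUx).of_le h2)
    rw [jY, jZ] at main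
    refine main.trans ?_
    change _ = g.form x (mlieBracket (𝓡 d) (mlieBracket (𝓡 d) K L) Y x) (Z x)
      + g.form x (Y x) (mlieBracket (𝓡 d) (mlieBracket (𝓡 d) K L) Z x)
    simp only [map_add, add_apply]
    ring

end LorentzianMetric

end Lorentzian

/-! ### Killing horizons -/

section Horizons

variable {n : ℕ} {M : Type*} [TopologicalSpace M]
  [ChartedSpace (EuclideanSpace ℝ (Fin (n + 1))) M] [IsManifold (𝓡 (n + 1)) ∞ M]
  {N : Type*} [TopologicalSpace N] [ChartedSpace (EuclideanSpace ℝ (Fin n)) N]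

/-- An injectively immersed hypersurface `H = ι(N)` of the `(n + 1)`-dimensional manifold `M`:
the image of a nonempty `n`-dimensional manifold `N` under an injective smooth immersion `ι`.
(Embedded hypersurfaces are the case in which `N` carries the subspace topology.) -/
structure IsHypersurface (n : ℕ) {M N : Type*} [TopologicalSpace M]
    [ChartedSpace (EuclideanSpace ℝ (Fin (n + 1))) M] [TopologicalSpace N]
    [ChartedSpace (EuclideanSpace ℝ (Fin n)) N] (ι : N → M) : Prop where
  nonempty : Nonempty N
  injective : Injective ι
  immersion : Manifold.IsImmersion (𝓡 n) (𝓡 (n + 1)) ∞ ι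

/-- The tangent space `T_a H ⊆ T_a M` of the hypersurface `H = ι(N)` at `a = ι p`. -/
def hypersurfaceTangent (n : ℕ) {M N : Type*} [TopologicalSpace M]
    [ChartedSpace (EuclideanSpace ℝ (Fin (n + 1))) M] [TopologicalSpace N]
    [ChartedSpace (EuclideanSpace ℝ (Fin n)) N] (ι : N → M) (p : N) :
    Submodule ℝ (TangentSpace (𝓡 (n + 1)) (ι p)) :=
  LinearMap.range (mfderiv (𝓡 n) (𝓡 (n + 1)) ι p).toLinearMap

namespace LorentzianMetric

variable (g : LorentzianMetric (n + 1) M) (ι : N → M)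

/-- `H = ι(N)` is a null hypersurface: the metric induced on each of its tangent spaces is
degenerate. -/
def IsNullHypersurface : Prop :=
  IsHypersurface n ι ∧ ∀ p : N, ∃ v ∈ hypersurfaceTangent n ι p, v ≠ 0 ∧
    ∀ w ∈ hypersurfaceTangent n ι p, g.form (ι p) v w = 0

/-- A Killing horizon: a null hypersurface for which there is a Killing vector field that is null,
tangent and nonzero at every point of it. -/
def IsKillingHorizon : Prop :=
  g.IsNullHypersurface ι ∧ ∃ K ∈ g.killingAlgebra, ∀ p : N,
    g.form (ι p) (K (ι p)) (K (ι p)) = 0 ∧ K (ι p) ∈ hypersurfaceTangent n ι p ∧ K (ι p) ≠ 0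

/-- Every Killing vector field is tangent to `H = ι(N)`. -/
def IsKillingInvariant : Prop :=
  ∀ X ∈ g.killingAlgebra, ∀ p : N, X (ι p) ∈ hypersurfaceTangent n ι p

/-- `K` is a generator of the horizon `H = ι(N)`: it is null on all of `H`, and tangent to `H` and
nonzero on an open dense subset of `H` (for the manifold topology of `H`). -/
def IsGenerator (K : SmoothVectorField (n + 1) M) : Prop :=
  (∀ p : N, g.form (ι p) (K (ι p)) (K (ι p)) = 0) ∧
    ∃ V : Set N, IsOpen V ∧ Dense V ∧
      ∀ p ∈ V, K (ι p) ∈ hypersurfaceTangent n ι p ∧ K (ι p) ≠ 0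

/-- The set of all Killing vector fields that are generators of the horizon, together with `0`. -/
def generators : Set g.killingAlgebra :=
  {K | g.IsGenerator ι (K : SmoothVectorField (n + 1) M) ∨ K = 0}

end LorentzianMetric

end Horizons

end

/-!
At a point of the null hypersurface `H` where a null generator `L` does not vanish, every Killing
field `K` that is normal to `H` is a multiple `α L`, since its value spans the same null direction.
A Killing field that vanishes on an open piece of a hypersurface has vanishing first jet there (its
derivative is skew with respect to the metric and kills a hyperplane), hence vanishes identically
because a Killing field solves a linear second-order system determining it from its first jet. So
the generators and `0` are exactly the Killing fields normal to `H`, and these form an ideal.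

Define the surface gravity `κ` of `L` at a point `p` of `H` by `d (g(L, L)) = -2 κ g(L, ·)`. If `K`
is a normal Killing field with value `α L` at `p`, then `X = K - α L` is a Killing field vanishing
at `p`, and differentiating `X (g(L, L)) = -2 g(L, [L, X])` there gives `[L, [L, K]] = -κ [L, K]` at
`p`. The bracket at `p` of two normal Killing fields with values `α₁ L` and `α₂ L` is
`α₁ [L, K₂] - α₂ [L, K₁]`, so `[L, W] = -κ W` at `p` for every `W` in the derived algebra of the
ideal, and therefore any two elements of the derived algebra have zero bracket at `p`. The ideal is
thus metabelian, and so contained in the radical.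
-/

noncomputable section

-- Needed for instances on iterated spaces such as `E →L[ℝ] E →L[ℝ] E →L[ℝ] ℝ`.
set_option maxSynthPendingDepth 3

section LinearAlgebra

theorem eq_zero_of_isAlt_of_isCoatom_le_ker {K E : Type*} [Field K] [AddCommGroup E] [Module K E]
    {B : E →ₗ[K] E →ₗ[K] K} (hB : B.IsAlt) {V : Submodule K E} (hV : IsCoatom V)
    (hBV : V ≤ LinearMap.ker B) : B = 0 := by
  ext z w
  by_cases hz : z ∈ V
  · simp [LinearMap.mem_ker.1 (hBV hz)]
  have hV_le : V ≤ LinearMap.ker (B z) := fun v hv ↦ by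
    rw [LinearMap.mem_ker, ← hB.neg, LinearMap.mem_ker.1 (hBV hv), LinearMap.zero_apply, neg_zero]
  have h_top : LinearMap.ker (B z) = ⊤ :=
    hV.2 _ (hV_le.lt_of_not_ge fun h ↦ hz (h (hB.self_eq_zero z)))
  simp [LinearMap.ker_eq_top.1 h_top]

theorem exists_eq_smul_of_forall_mem_isCoatom {K E : Type*} [Field K] [AddCommGroup E] [Module K E]
    {V : Submodule K E} (hV : IsCoatom V) {ℓ φ : E →ₗ[K] K} (hℓ : ℓ ≠ 0)
    (hℓV : ∀ v ∈ V, ℓ v = 0) (hφV : ∀ v ∈ V, φ v = 0) : ∃ m : K, φ = m • ℓ := by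
  have h_ker : LinearMap.ker ℓ = V :=
    (hV.le_iff.1 (fun v hv ↦ hℓV v hv : V ≤ LinearMap.ker ℓ)).resolve_left
      (mt LinearMap.ker_eq_top.1 hℓ)
  have h_span : φ ∈ Submodule.span K (range fun _ : Unit ↦ ℓ) :=
    mem_span_of_iInf_ker_le_ker (by simpa [h_ker, SetLike.le_def] using hφV)
  simpa [range_const, Submodule.mem_span_singleton, eq_comm] using h_span

end LinearAlgebra

section Calculus

variable {E F F₁ F₂ : Type*} [NormedAddCommGroup E] [NormedSpace ℝ E]
  [NormedAddCommGroup F] [NormedSpace ℝ F] [NormedAddCommGroup F₁] [NormedSpace ℝ F₁]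
  [NormedAddCommGroup F₂] [NormedSpace ℝ F₂]

theorem eventually_forall_mul_norm_le {α : Type*} [FiniteDimensional ℝ E] {l : Filter α}
    {A : α → E →L[ℝ] F} {B : E →L[ℝ] F} (hA : Tendsto A l (𝓝 B)) (hB : Injective B) :
    ∃ c > 0, ∀ᶠ a in l, ∀ v, c * ‖v‖ ≤ ‖A a v‖ := by
  obtain ⟨K, hK, hBK⟩ :=
    LinearMap.exists_antilipschitzWith B.toLinearMap (LinearMap.ker_eq_bot.2 hB)
  refine ⟨(K : ℝ)⁻¹ / 2, by positivity, ?_⟩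
  filter_upwards [(tendsto_iff_norm_sub_tendsto_zero.1 hA).eventually_lt_const
    (show 0 < (K : ℝ)⁻¹ / 2 by positivity)] with a ha v
  have h_lower : (K : ℝ)⁻¹ * ‖v‖ ≤ ‖B v‖ := by
    rw [inv_mul_le_iff₀ (by positivity)]
    exact hBK.le_mul_norm (map_zero B) v
  have h_diff : ‖B v - A a v‖ ≤ (K : ℝ)⁻¹ / 2 * ‖v‖ := by
    rw [norm_sub_rev]
    exact (A a - B).le_of_opNorm_le ha.le v
  linarith [norm_le_norm_add_norm_sub' (B v) (A a v)]

theorem differentiableAt_of_contDiffOn {f : E → F} {U : Set E} (hf : ContDiffOn ℝ ∞ f U)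
    (hU : IsOpen U) {x : E} (hx : x ∈ U) : DifferentiableAt ℝ f x :=
  (hf.differentiableOn (by simp)).differentiableAt (hU.mem_nhds hx)

theorem differentiableAt_fderiv_of_contDiffOn {f : E → F} {U : Set E} (hf : ContDiffOn ℝ ∞ f U)
    (hU : IsOpen U) {x : E} (hx : x ∈ U) : DifferentiableAt ℝ (fderiv ℝ f) x :=
  differentiableAt_of_contDiffOn (hf.fderiv_of_isOpen hU (by simp)) hU hx

theorem exists_eventually_norm_fderiv_le {f : E → F} {U : Set E} (hf : ContDiffOn ℝ ∞ f U)
    (hU : IsOpen U) {x : E} (hx : x ∈ U) :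
    ∃ C, ∀ᶠ y in 𝓝 x, ‖fderiv ℝ f y‖ ≤ C ∧ ‖fderiv ℝ (fderiv ℝ f) y‖ ≤ C := by
  have hDf : ContDiffOn ℝ ∞ (fderiv ℝ f) U := hf.fderiv_of_isOpen hU (by simp)
  have h_cont := (differentiableAt_of_contDiffOn hDf hU hx).continuousAt.norm.max
    (differentiableAt_fderiv_of_contDiffOn hDf hU hx).continuousAt.norm
  exact ⟨_, (h_cont.eventually_lt_const (lt_add_one _)).mono fun y hy ↦ max_le_iff.1 hy.le⟩

theorem fderiv_clm_apply₂ {B : E → F₁ →L[ℝ] F₂ →L[ℝ] F} {Y : E → F₁} {Z : E → F₂} {x : E}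
    (hB : DifferentiableAt ℝ B x) (hY : DifferentiableAt ℝ Y x) (hZ : DifferentiableAt ℝ Z x)
    (v : E) : fderiv ℝ (fun y ↦ B y (Y y) (Z y)) x v =
      fderiv ℝ B x v (Y x) (Z x) + B x (fderiv ℝ Y x v) (Z x) + B x (Y x) (fderiv ℝ Z x v) := by
  rw [fderiv_clm_apply (hB.clm_apply hY) hZ, fderiv_clm_apply hB hY]
  simp only [add_apply, ContinuousLinearMap.comp_apply, ContinuousLinearMap.flip_apply]
  abel

theorem fderiv_apply_mem_of_eventually_mem {f : E → F} {x : E} (hf : DifferentiableAt ℝ f x)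
    {V : Submodule ℝ E} {W : Submodule ℝ F} (hW : IsClosed (W : Set F)) (hx : x ∈ V)
    (h : ∀ᶠ y in 𝓝[V] x, f y ∈ W) {v : E} (hv : v ∈ V) : fderiv ℝ f x v ∈ W := by
  have h_line : Tendsto (fun t : ℝ ↦ x + t • v) (𝓝 0) (𝓝[V] x) :=
    tendsto_nhdsWithin_iff.2 ⟨Continuous.tendsto' (by fun_prop) _ _ (by simp),
      .of_forall fun t ↦ V.add_mem hx (V.smul_mem t hv)⟩
  have h_slope : Tendsto (fun t : ℝ ↦ t⁻¹ • (f (x + t • v) - f x)) (𝓝[≠] 0)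
      (𝓝 (fderiv ℝ f x v)) :=
    hasLineDerivAt_iff_tendsto_slope_zero.1 (hf.hasFDerivAt.hasLineDerivAt v)
  refine hW.mem_of_tendsto h_slope ?_
  filter_upwards [nhdsWithin_le_nhds (h_line.eventually h)] with t ht
  exact W.smul_mem _ (W.sub_mem ht (h.self_of_nhdsWithin hx))

theorem fderiv_apply_eq_zero_of_eventually_eq_zero {f : E → F} {x : E}
    (hf : DifferentiableAt ℝ f x) {V : Submodule ℝ E} (hx : x ∈ V) (h : ∀ᶠ y in 𝓝[V] x, f y = 0)
    {v : E} (hv : v ∈ V) : fderiv ℝ f x v = 0 := by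
  simpa using fderiv_apply_mem_of_eventually_mem hf (W := ⊥) (by simp) hx (by simpa using h) hv

/-- Along each segment from `a`, the first-order jet of `f` satisfies a linear ODE inequality,
to which Grönwall's inequality applies. -/
theorem eqOn_zero_of_norm_fderiv_fderiv_le {f : E → F} {B : Set E} (hB : IsOpen B)
    (hconv : Convex ℝ B) (hf : ContDiffOn ℝ ∞ f B) {C : ℝ}
    (hC : ∀ x ∈ B, ‖fderiv ℝ (fderiv ℝ f) x‖ ≤ C * ‖(f x, fderiv ℝ f x)‖)
    {a : E} (ha : a ∈ B) (h0 : f a = 0) (h1 : fderiv ℝ f a = 0) : EqOn f 0 B := by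
  intro y hy
  let γ : ℝ → E := AffineMap.lineMap a y
  have hγ : ∀ t ∈ Icc (0 : ℝ) 1, γ t ∈ B := fun t ht ↦ hconv.lineMap_mem ha hy ht
  have h_deriv : ∀ t ∈ Icc (0 : ℝ) 1, HasDerivAt (fun t ↦ (f (γ t), fderiv ℝ f (γ t)))
      (fderiv ℝ f (γ t) (y - a), fderiv ℝ (fderiv ℝ f) (γ t) (y - a)) t := fun t ht ↦
    ((differentiableAt_of_contDiffOn hf hB (hγ t ht)).hasFDerivAt.comp_hasDerivAt t
      AffineMap.hasDerivAt_lineMap).prodMk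
      ((differentiableAt_fderiv_of_contDiffOn hf hB (hγ t ht)).hasFDerivAt.comp_hasDerivAt t
        AffineMap.hasDerivAt_lineMap)
  have h_bound : ∀ t ∈ Icc (0 : ℝ) 1,
      ‖(fderiv ℝ f (γ t) (y - a), fderiv ℝ (fderiv ℝ f) (γ t) (y - a))‖ ≤
        max 1 C * ‖y - a‖ * ‖(f (γ t), fderiv ℝ f (γ t))‖ := fun t ht ↦ by
    rw [mul_right_comm, Prod.norm_mk]
    refine max_le (ContinuousLinearMap.le_of_opNorm_le _ ?_ _)
      (ContinuousLinearMap.le_of_opNorm_le _ ((hC _ (hγ t ht)).trans ?_) _)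
    · exact (norm_snd_le (f (γ t), fderiv ℝ f (γ t))).trans
        (le_mul_of_one_le_left (norm_nonneg _) (le_max_left _ _))
    · gcongr
      exact le_max_right _ _
  have h_zero := eq_zero_of_abs_deriv_le_mul_abs_self_of_eq_zero_right
    (fun t ht ↦ (h_deriv t ht).continuousAt.continuousWithinAt)
    (fun t ht ↦ (h_deriv t (Ico_subset_Icc_self ht)).hasDerivWithinAt)
    (by simp [γ, h0, h1]) (fun t ht ↦ h_bound t (Ico_subset_Icc_self ht)) 1 (by simp)
  simpa [γ] using congrArg Prod.fst h_zero

end Calculus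

section KillingOn

variable {E : Type*} [NormedAddCommGroup E] [NormedSpace ℝ E]

/-- `G` is a smooth pseudo-Riemannian metric on the open subset `U` of a vector space. In infinite
dimensions nondegeneracy is meant in the weak sense, that of injectivity of `v ↦ G x v`. -/
structure IsPseudoRiemannianOn (G : E → E →L[ℝ] E →L[ℝ] ℝ) (U : Set E) : Prop where
  isOpen : IsOpen U
  contDiffOn : ContDiffOn ℝ ∞ G U
  symm : ∀ x ∈ U, ∀ v w, G x v w = G x w v
  injective : ∀ x ∈ U, Injective (G x)

/-- `X` is a smooth Killing field on `U` for the field `G` of bilinear forms: the condition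
`killing` says that the Lie derivative of `G` along `X` vanishes. -/
structure IsKillingOn (G : E → E →L[ℝ] E →L[ℝ] ℝ) (U : Set E) (X : E → E) : Prop where
  contDiffOn : ContDiffOn ℝ ∞ X U
  killing : ∀ x ∈ U, ∀ v w : E,
    fderiv ℝ G x (X x) v w + G x (fderiv ℝ X x v) w + G x v (fderiv ℝ X x w) = 0

/-- The terms of order at most one in `X` in the derivative at `x`, in the direction `w`, of the
Killing equation paired with `u` and `v`. -/
def killingRemainder (G : E → E →L[ℝ] E →L[ℝ] ℝ) (X : E → E) (x w u v : E) : ℝ :=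
  fderiv ℝ (fderiv ℝ G) x w (X x) u v + fderiv ℝ G x (fderiv ℝ X x w) u v
    + fderiv ℝ G x w (fderiv ℝ X x u) v + fderiv ℝ G x w u (fderiv ℝ X x v)

theorem norm_killingRemainder_le (G : E → E →L[ℝ] E →L[ℝ] ℝ) (X : E → E) (x w u v : E) :
    ‖killingRemainder G X x w u v‖ ≤ (‖fderiv ℝ (fderiv ℝ G) x‖ + 3 * ‖fderiv ℝ G x‖)
      * ‖(X x, fderiv ℝ X x)‖ * ‖w‖ * ‖u‖ * ‖v‖ := by
  set j := ‖(X x, fderiv ℝ X x)‖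
  have hX : ‖X x‖ ≤ j := norm_fst_le (X x, fderiv ℝ X x)
  have hDX (a : E) : ‖fderiv ℝ X x a‖ ≤ j * ‖a‖ :=
    ContinuousLinearMap.le_of_opNorm_le _ (norm_snd_le (X x, fderiv ℝ X x)) a
  have hDG {a b c : E} {α β γ : ℝ} (ha : ‖a‖ ≤ α) (hb : ‖b‖ ≤ β) (hc : ‖c‖ ≤ γ) :
      ‖fderiv ℝ G x a b c‖ ≤ ‖fderiv ℝ G x‖ * α * β * γ :=
    ContinuousLinearMap.le_of_opNorm_le_of_le _ (ContinuousLinearMap.le_of_opNorm_le_of_le _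
      (ContinuousLinearMap.le_of_opNorm_le_of_le _ le_rfl ha) hb) hc
  have h₁ : ‖fderiv ℝ (fderiv ℝ G) x w (X x) u v‖ ≤
      ‖fderiv ℝ (fderiv ℝ G) x‖ * ‖w‖ * j * ‖u‖ * ‖v‖ :=
    ContinuousLinearMap.le_of_opNorm_le_of_le _ (ContinuousLinearMap.le_of_opNorm_le_of_le _
      (ContinuousLinearMap.le_of_opNorm_le_of_le _ (ContinuousLinearMap.le_opNorm _ _) hX) le_rfl)
      le_rfl
  have h₂ := hDG (hDX w) (le_refl ‖u‖) (le_refl ‖v‖)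
  have h₃ := hDG (le_refl ‖w‖) (hDX u) (le_refl ‖v‖)
  have h₄ := hDG (le_refl ‖w‖) (le_refl ‖u‖) (hDX v)
  calc ‖killingRemainder G X x w u v‖ ≤ _ := norm_add₄_le
    _ ≤ _ := add_le_add (add_le_add (add_le_add h₁ h₂) h₃) h₄
    _ = _ := by ring

variable {G : E → E →L[ℝ] E →L[ℝ] ℝ} {U : Set E} {X Y : E → E} {x : E}

theorem IsPseudoRiemannianOn.differentiableAt (hG : IsPseudoRiemannianOn G U) (hx : x ∈ U) :
    DifferentiableAt ℝ G x :=
  differentiableAt_of_contDiffOn hG.contDiffOn hG.isOpen hx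

namespace IsKillingOn

theorem congr (hX : IsKillingOn G U X) (hU : IsOpen U) (h : EqOn Y X U) : IsKillingOn G U Y where
  contDiffOn := hX.contDiffOn.congr h
  killing x hx v w := by
    have h_eventually : Y =ᶠ[𝓝 x] X := eventually_of_mem (hU.mem_nhds hx) h
    rw [h hx, h_eventually.fderiv_eq]
    exact hX.killing x hx v w

theorem sub_smul (hX : IsKillingOn G U X) (hY : IsKillingOn G U Y) (hU : IsOpen U) (c : ℝ) :
    IsKillingOn G U (X - c • Y) where
  contDiffOn := hX.contDiffOn.sub (hY.contDiffOn.const_smul c)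
  killing x hx v w := by
    have dX := differentiableAt_of_contDiffOn hX.contDiffOn hU hx
    have dY := differentiableAt_of_contDiffOn hY.contDiffOn hU hx
    rw [fderiv_sub dX (dY.const_smul c), fderiv_const_smul dY]
    simp only [Pi.sub_apply, Pi.smul_apply, map_sub, map_smul, sub_apply, smul_apply, smul_eq_mul]
    linear_combination hX.killing x hx v w - c * hY.killing x hx v w

theorem fderiv_fderiv_pairing (hX : IsKillingOn G U X) (hG : IsPseudoRiemannianOn G U)
    (hx : x ∈ U) (w u v : E) :
    G x (fderiv ℝ (fderiv ℝ X) x w u) v + G x u (fderiv ℝ (fderiv ℝ X) x w v) =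
      -killingRemainder G X x w u v := by
  have dG := hG.differentiableAt hx
  have dDG := differentiableAt_fderiv_of_contDiffOn hG.contDiffOn hG.isOpen hx
  have dX := differentiableAt_of_contDiffOn hX.contDiffOn hG.isOpen hx
  have dDX := differentiableAt_fderiv_of_contDiffOn hX.contDiffOn hG.isOpen hx
  have du := (hasFDerivAt_const (𝕜 := ℝ) u x)
  have dv := (hasFDerivAt_const (𝕜 := ℝ) v x)
  have h_killing : (fun y ↦ fderiv ℝ G y (X y) u v + G y (fderiv ℝ X y u) v
      + G y u (fderiv ℝ X y v)) =ᶠ[𝓝 x] fun _ ↦ 0 :=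
    eventually_of_mem (hG.isOpen.mem_nhds hx) fun y hy ↦ hX.killing y hy u v
  have h_deriv := (((((dDG.hasFDerivAt.clm_apply dX.hasFDerivAt).clm_apply du).clm_apply dv).add
    ((dG.hasFDerivAt.clm_apply (dDX.hasFDerivAt.clm_apply du)).clm_apply dv)).add
    ((dG.hasFDerivAt.clm_apply du).clm_apply (dDX.hasFDerivAt.clm_apply dv))).congr_of_eventuallyEq
      h_killing.symm |>.unique (hasFDerivAt_const 0 x)
  have h_deriv_w := DFunLike.congr_fun h_deriv w
  simp only [ContinuousLinearMap.comp_zero, ContinuousLinearMap.flip_add, add_apply, zero_add,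
    ContinuousLinearMap.flip_apply, ContinuousLinearMap.comp_apply, zero_apply] at h_deriv_w
  unfold killingRemainder
  linarith

/-- The computation is that of the Koszul formula for the Levi-Civita connection. -/
theorem two_mul_fderiv_fderiv_pairing (hX : IsKillingOn G U X) (hG : IsPseudoRiemannianOn G U)
    (hx : x ∈ U) (w u v : E) :
    2 * G x (fderiv ℝ (fderiv ℝ X) x w u) v = killingRemainder G X x v w u
      - killingRemainder G X x w u v - killingRemainder G X x u w v := by
  have h_smooth : ContDiffAt ℝ ∞ X x := hX.contDiffOn.contDiffAt (hG.isOpen.mem_nhds hx)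
  have h_symm (a b : E) : fderiv ℝ (fderiv ℝ X) x a b = fderiv ℝ (fderiv ℝ X) x b a :=
    h_smooth.isSymmSndFDerivAt (by simpa using ENat.LEInfty.out) a b
  have h_w := hX.fderiv_fderiv_pairing hG hx w u v
  have h_u := hX.fderiv_fderiv_pairing hG hx u w v
  have h_v := hX.fderiv_fderiv_pairing hG hx v w u
  rw [hG.symm x hx u] at h_w
  rw [hG.symm x hx w, h_symm u w] at h_u
  rw [hG.symm x hx w, h_symm v w, h_symm v u] at h_v
  linarith

theorem norm_fderiv_fderiv_le (hX : IsKillingOn G U X) (hG : IsPseudoRiemannianOn G U)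
    (hx : x ∈ U) {c : ℝ} (hc : 0 < c) (hGc : ∀ v, c * ‖v‖ ≤ ‖G x v‖) :
    ‖fderiv ℝ (fderiv ℝ X) x‖ ≤ 3 / 2 * (‖fderiv ℝ (fderiv ℝ G) x‖ + 3 * ‖fderiv ℝ G x‖) / c
      * ‖(X x, fderiv ℝ X x)‖ := by
  set C := ‖fderiv ℝ (fderiv ℝ G) x‖ + 3 * ‖fderiv ℝ G x‖
  set j := ‖(X x, fderiv ℝ X x)‖
  refine ContinuousLinearMap.opNorm_le_bound₂ _ (by positivity) fun w u ↦ ?_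
  have h_flat : ‖G x (fderiv ℝ (fderiv ℝ X) x w u)‖ ≤ 3 / 2 * C * j * ‖w‖ * ‖u‖ := by
    refine ContinuousLinearMap.opNorm_le_bound _ (by positivity) fun v ↦ ?_
    have h_koszul := congrArg norm (hX.two_mul_fderiv_fderiv_pairing hG hx w u v)
    rw [norm_mul, Real.norm_ofNat] at h_koszul
    have h_tri := norm_sub_le (killingRemainder G X x v w u - killingRemainder G X x w u v)
      (killingRemainder G X x u w v)
    have h_tri' := norm_sub_le (killingRemainder G X x v w u) (killingRemainder G X x w u v)
    linarith [norm_killingRemainder_le G X x v w u, norm_killingRemainder_le G X x w u v,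
      norm_killingRemainder_le G X x u w v]
  calc ‖fderiv ℝ (fderiv ℝ X) x w u‖ ≤ (3 / 2 * C * j * ‖w‖ * ‖u‖) / c :=
        (le_div_iff₀' hc).2 ((hGc _).trans h_flat)
    _ = 3 / 2 * C / c * j * ‖w‖ * ‖u‖ := by ring

end IsKillingOn

theorem IsPseudoRiemannianOn.exists_eventually_norm_fderiv_fderiv_le [FiniteDimensional ℝ E]
    (hG : IsPseudoRiemannianOn G U) (hx : x ∈ U) :
    ∃ C, ∀ᶠ y in 𝓝 x, ∀ X, IsKillingOn G U X →
      ‖fderiv ℝ (fderiv ℝ X) y‖ ≤ C * ‖(X y, fderiv ℝ X y)‖ := by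
  obtain ⟨c, hc, h_lower⟩ := eventually_forall_mul_norm_le
    (hG.differentiableAt hx).continuousAt.tendsto (hG.injective x hx)
  obtain ⟨C, hC⟩ := exists_eventually_norm_fderiv_le hG.contDiffOn hG.isOpen hx
  refine ⟨3 / 2 * (C + 3 * C) / c, ?_⟩
  filter_upwards [hG.isOpen.mem_nhds hx, h_lower, hC] with y hy hyc hyC X hX
  refine (hX.norm_fderiv_fderiv_le hG hy hc hyc).trans ?_
  gcongr
  exacts [hyC.2, hyC.1]

theorem IsPseudoRiemannianOn.exists_mem_nhds_eqOn_zero [FiniteDimensional ℝ E]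
    (hG : IsPseudoRiemannianOn G U) (hx : x ∈ U) :
    ∃ B ∈ 𝓝 x, ∀ X, IsKillingOn G U X → ∀ a ∈ B, X a = 0 → fderiv ℝ X a = 0 → EqOn X 0 B := by
  obtain ⟨C, hC⟩ := hG.exists_eventually_norm_fderiv_fderiv_le hx
  obtain ⟨r, hr, hball⟩ := Metric.eventually_nhds_iff_ball.1 (hC.and (hG.isOpen.mem_nhds hx))
  refine ⟨Metric.ball x r, Metric.ball_mem_nhds x hr, fun X hX a ha h0 h1 ↦ ?_⟩
  exact eqOn_zero_of_norm_fderiv_fderiv_le Metric.isOpen_ball (convex_ball x r)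
    (hX.contDiffOn.mono fun y hy ↦ (hball y hy).2) (fun y hy ↦ (hball y hy).1 X hX) ha h0 h1

end KillingOn

section Hyperplanes

variable {E : Type*} [NormedAddCommGroup E] [NormedSpace ℝ E]
variable {G : E → E →L[ℝ] E →L[ℝ] ℝ} {U : Set E} {X Y L K : E → E} {x : E}
  {V : Submodule ℝ E}

theorem lieBracket_sub_smul_self (hL : DifferentiableAt ℝ L x) (hX : DifferentiableAt ℝ X x)
    (c : ℝ) : lieBracket ℝ L (X - c • L) x = lieBracket ℝ L X x := by
  simp [lieBracket_eq, fderiv_sub hX (hL.const_smul c), fderiv_const_smul hL]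

theorem IsPseudoRiemannianOn.exists_surfaceGravity (hG : IsPseudoRiemannianOn G U) (hx : x ∈ U)
    (hL : DifferentiableAt ℝ L x) (hL0 : L x ≠ 0) (hV : IsCoatom V) (hxV : x ∈ V)
    (hLV : ∀ v ∈ V, G x (L x) v = 0) (hnull : ∀ᶠ y in 𝓝[V] x, G y (L y) (L y) = 0) :
    ∃ κ : ℝ, ∀ v, fderiv ℝ (fun y ↦ G y (L y) (L y)) x v = -2 * κ * G x (L x) v := by
  have hGL : G x (L x) ≠ 0 := (map_ne_zero_iff (G x) (hG.injective x hx)).2 hL0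
  have dGLL := ((hG.differentiableAt hx).clm_apply hL).clm_apply hL
  obtain ⟨m, hm⟩ := exists_eq_smul_of_forall_mem_isCoatom hV (ℓ := (G x (L x)).toLinearMap)
    (φ := (fderiv ℝ (fun y ↦ G y (L y) (L y)) x).toLinearMap)
    (fun h ↦ hGL (ContinuousLinearMap.coe_injective h)) hLV
    (fun v ↦ fderiv_apply_eq_zero_of_eventually_eq_zero dGLL hxV hnull)
  refine ⟨-m / 2, fun v ↦ (LinearMap.congr_fun hm v).trans ?_⟩
  simp only [LinearMap.smul_apply, ContinuousLinearMap.coe_coe, smul_eq_mul]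
  ring

namespace IsKillingOn

theorem fderiv_form_apply {Z : E → E} (hX : IsKillingOn G U X) (hG : IsPseudoRiemannianOn G U)
    (hx : x ∈ U) (hY : DifferentiableAt ℝ Y x) (hZ : DifferentiableAt ℝ Z x) :
    fderiv ℝ (fun y ↦ G y (Y y) (Z y)) x (X x) =
      G x (lieBracket ℝ X Y x) (Z x) + G x (Y x) (lieBracket ℝ X Z x) := by
  rw [fderiv_clm_apply₂ (hG.differentiableAt hx) hY hZ]
  simp only [lieBracket_eq, map_sub, sub_apply]
  linarith [hX.killing x hx (Y x) (Z x)]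

theorem fderiv_eq_zero_of_eventually_eq_zero (hX : IsKillingOn G U X)
    (hG : IsPseudoRiemannianOn G U) (hx : x ∈ U) (hV : IsCoatom V) (hxV : x ∈ V)
    (h : ∀ᶠ y in 𝓝[V] x, X y = 0) : fderiv ℝ X x = 0 := by
  have hX0 : X x = 0 := h.self_of_nhdsWithin hxV
  have hDX : ∀ v ∈ V, fderiv ℝ X x v = 0 := fun v ↦ fderiv_apply_eq_zero_of_eventually_eq_zero
    (differentiableAt_of_contDiffOn hX.contDiffOn hG.isOpen hx) hxV h
  let B : E →ₗ[ℝ] E →ₗ[ℝ] ℝ := (G x ∘L fderiv ℝ X x).toLinearMap₁₂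
  have hB_alt : B.IsAlt := fun v ↦ by
    have h_killing := hX.killing x hx v v
    rw [hX0, map_zero, hG.symm x hx v] at h_killing
    simp only [zero_apply, zero_add, add_self_eq_zero] at h_killing
    exact h_killing
  have hB : B = 0 := eq_zero_of_isAlt_of_isCoatom_le_ker hB_alt hV fun v hv ↦ by
    ext w
    simp [B, hDX v hv]
  ext v
  refine hG.injective x hx (ContinuousLinearMap.ext fun w ↦ ?_)
  simpa [B] using LinearMap.congr_fun₂ hB v w

theorem form_lieBracket_eq_zero_of_mem (hX : IsKillingOn G U X)
    (hG : IsPseudoRiemannianOn G U) (hx : x ∈ U) (hK : DifferentiableAt ℝ K x)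
    (hV : IsClosed (V : Set E)) (hxV : x ∈ V)
    (hKV : ∀ᶠ y in 𝓝[V] x, ∀ v ∈ V, G y (K y) v = 0) (hXV : ∀ᶠ y in 𝓝[V] x, X y ∈ V)
    {v : E} (hv : v ∈ V) : G x (lieBracket ℝ X K x) v = 0 := by
  have hDX : fderiv ℝ X x v ∈ V := fderiv_apply_mem_of_eventually_mem
    (differentiableAt_of_contDiffOn hX.contDiffOn hG.isOpen hx) hV hxV hXV hv
  have h_deriv : fderiv ℝ (fun y ↦ G y (K y) v) x (X x) = 0 :=
    fderiv_apply_eq_zero_of_eventually_eq_zero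
      (((hG.differentiableAt hx).clm_apply hK).clm_apply (differentiableAt_const v)) hxV
      (hKV.mono fun y hy ↦ hy v hv) (hXV.self_of_nhdsWithin hxV)
  rw [hX.fderiv_form_apply hG hx hK (differentiableAt_const v)] at h_deriv
  simpa [lieBracket_eq, hKV.self_of_nhdsWithin hxV _ hDX] using h_deriv

theorem form_fderiv_eq_of_lieBracket_eq_smul (hX : IsKillingOn G U X) (hx : x ∈ U)
    (hX0 : X x = 0) {b : ℝ} (hb : lieBracket ℝ L X x = b • L x) (v : E) :
    G x (L x) (fderiv ℝ X x v) = -b * G x (L x) v := by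
  have hDX : fderiv ℝ X x (L x) = b • L x := by simpa [lieBracket_eq, hX0] using hb
  have h_killing := hX.killing x hx (L x) v
  simp only [hX0, hDX, map_zero, zero_apply, map_smul, smul_apply, smul_eq_mul] at h_killing
  linarith

theorem fderiv_form_self_apply_fderiv (hX : IsKillingOn G U X) (hG : IsPseudoRiemannianOn G U)
    (hx : x ∈ U) (hL : ContDiffOn ℝ ∞ L U) (hLX : ContDiffOn ℝ ∞ (lieBracket ℝ L X) U)
    (hX0 : X x = 0) (v : E) :
    fderiv ℝ (fun y ↦ G y (L y) (L y)) x (fderiv ℝ X x v) =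
      -2 * fderiv ℝ (fun y ↦ G y (L y) (lieBracket ℝ L X y)) x v := by
  have h_smooth : ContDiffOn ℝ ∞ (fun y ↦ G y (L y) (L y)) U :=
    (hG.contDiffOn.clm_apply hL).clm_apply hL
  have h_smooth' : ContDiffOn ℝ ∞ (fun y ↦ G y (L y) (lieBracket ℝ L X y)) U :=
    (hG.contDiffOn.clm_apply hL).clm_apply hLX
  have h_killing : (fun y ↦ fderiv ℝ (fun y ↦ G y (L y) (L y)) y (X y)) =ᶠ[𝓝 x]
      fun y ↦ -2 * G y (L y) (lieBracket ℝ L X y) := by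
    filter_upwards [hG.isOpen.mem_nhds hx] with y hy
    have dL := differentiableAt_of_contDiffOn hL hG.isOpen hy
    have h_swap : G y (L y) (lieBracket ℝ X L y) = -G y (L y) (lieBracket ℝ L X y) := by
      rw [← map_neg (G y (L y)), ← lieBracket_swap]
    rw [hX.fderiv_form_apply hG hy dL dL, hG.symm y hy _ (L y), h_swap]
    ring
  have h_deriv := DFunLike.congr_fun (h_killing.fderiv_eq (𝕜 := ℝ)) v
  rw [fderiv_clm_apply (differentiableAt_fderiv_of_contDiffOn h_smooth hG.isOpen hx)
    (differentiableAt_of_contDiffOn hX.contDiffOn hG.isOpen hx),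
    fderiv_const_mul (differentiableAt_of_contDiffOn h_smooth' hG.isOpen hx)] at h_deriv
  simpa [hX0] using h_deriv

/-- At a zero of `X`, differentiate `X (G(L, L)) = -2 G(L, [L, X])`. -/
theorem eq_neg_mul_of_apply_eq_zero (hL : IsKillingOn G U L) (hX : IsKillingOn G U X)
    (hLX : IsKillingOn G U (lieBracket ℝ L X)) (hG : IsPseudoRiemannianOn G U) (hx : x ∈ U)
    (hL0 : L x ≠ 0) (hX0 : X x = 0) {κ β γ : ℝ}
    (hκ : ∀ v, fderiv ℝ (fun y ↦ G y (L y) (L y)) x v = -2 * κ * G x (L x) v)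
    (hβ : lieBracket ℝ L X x = β • L x)
    (hγ : lieBracket ℝ L (lieBracket ℝ L X) x = γ • L x) : γ = -κ * β := by
  have dL := differentiableAt_of_contDiffOn hL.contDiffOn hG.isOpen hx
  have dLX := differentiableAt_of_contDiffOn hLX.contDiffOn hG.isOpen hx
  have hGL : G x (L x) ≠ 0 := (map_ne_zero_iff (G x) (hG.injective x hx)).2 hL0
  obtain ⟨v, hv⟩ := DFunLike.ne_iff.1 hGL
  have h_ne : G x (L x) v ≠ 0 := hv
  set X' := lieBracket ℝ L X - β • L
  have hX'0 : X' x = 0 := by simp [X', hβ]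
  have hX' : G x (L x) (fderiv ℝ X' x v) = -γ * G x (L x) v :=
    (hLX.sub_smul hL hG.isOpen β).form_fderiv_eq_of_lieBracket_eq_smul hx hX'0
      (by rw [lieBracket_sub_smul_self dL dLX, hγ]) v
  have h_first : fderiv ℝ (fun y ↦ G y (L y) (lieBracket ℝ L X y)) x v =
      (-γ - 2 * κ * β) * G x (L x) v := by
    have h_LL := hκ v
    rw [fderiv_clm_apply₂ (hG.differentiableAt hx) dL dL] at h_LL
    rw [fderiv_clm_apply₂ (hG.differentiableAt hx) dL dLX, hβ]
    rw [fderiv_sub dLX (dL.const_smul β), fderiv_const_smul dL] at hX'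
    simp only [sub_apply, smul_apply, map_sub, map_smul, smul_eq_mul] at hX' ⊢
    linear_combination β * h_LL + hX'
  have h_second := hX.fderiv_form_self_apply_fderiv hG hx hL.contDiffOn hLX.contDiffOn hX0 v
  rw [hκ, h_first, hX.form_fderiv_eq_of_lieBracket_eq_smul hx hX0 hβ] at h_second
  refine mul_right_cancel₀ h_ne ?_
  linear_combination -h_second / 2

theorem eq_neg_mul_of_apply_eq_smul (hL : IsKillingOn G U L) (hK : IsKillingOn G U K)
    (hLK : IsKillingOn G U (lieBracket ℝ L K)) (hG : IsPseudoRiemannianOn G U) (hx : x ∈ U)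
    (hL0 : L x ≠ 0) {κ α β γ : ℝ}
    (hκ : ∀ v, fderiv ℝ (fun y ↦ G y (L y) (L y)) x v = -2 * κ * G x (L x) v)
    (hα : K x = α • L x) (hβ : lieBracket ℝ L K x = β • L x)
    (hγ : lieBracket ℝ L (lieBracket ℝ L K) x = γ • L x) : γ = -κ * β := by
  have h_bracket : EqOn (lieBracket ℝ L (K - α • L)) (lieBracket ℝ L K) U := fun y hy ↦
    lieBracket_sub_smul_self (differentiableAt_of_contDiffOn hL.contDiffOn hG.isOpen hy)
      (differentiableAt_of_contDiffOn hK.contDiffOn hG.isOpen hy) α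
  have h_eventually : lieBracket ℝ L (K - α • L) =ᶠ[𝓝 x] lieBracket ℝ L K :=
    eventually_of_mem (hG.isOpen.mem_nhds hx) h_bracket
  refine hL.eq_neg_mul_of_apply_eq_zero (hK.sub_smul hL hG.isOpen α)
    (hLK.congr hG.isOpen h_bracket) hG hx hL0 (by simp [hα]) hκ ((h_bracket hx).trans hβ) ?_
  rw [EventuallyEq.rfl.lieBracket_vectorField_eq h_eventually, hγ]

end IsKillingOn

end Hyperplanes

section Charts

variable {E : Type*} [NormedAddCommGroup E] [NormedSpace ℝ E] {M : Type*} [TopologicalSpace M]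
  [ChartedSpace E M] {ψ : OpenPartialHomeomorph M E}

/-- The expression of a vector field in the chart `ψ`, as a vector field on the model space. It is
meaningful on `ψ.target` only. -/
def chartField (ψ : OpenPartialHomeomorph M E) (X : ∀ x : M, TangentSpace 𝓘(ℝ, E) x) : E → E :=
  mpullback 𝓘(ℝ, E) 𝓘(ℝ, E) ψ.symm X

/-- The coordinate vector field of the chart `ψ` whose expression in `ψ` is the constant `v`. It is
meaningful on `ψ.source` only. -/
def coordinateField (ψ : OpenPartialHomeomorph M E) (v : E) : ∀ x : M, TangentSpace 𝓘(ℝ, E) x :=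
  mpullback 𝓘(ℝ, E) 𝓘(ℝ, E) ψ (fun _ ↦ v)

/-- The expression of a field of bilinear forms in the chart `ψ`, as a field of bilinear forms on
the model space. It is meaningful on `ψ.target` only. -/
def chartForm (ψ : OpenPartialHomeomorph M E)
    (B : ∀ x : M, TangentSpace 𝓘(ℝ, E) x →L[ℝ] TangentSpace 𝓘(ℝ, E) x →L[ℝ] ℝ) (u : E) :
    E →L[ℝ] E →L[ℝ] ℝ :=
  ContinuousLinearMap.bilinearComp (E := E) (F := E) (B (ψ.symm u))
    (mfderiv 𝓘(ℝ, E) 𝓘(ℝ, E) ψ.symm u) (mfderiv 𝓘(ℝ, E) 𝓘(ℝ, E) ψ.symm u)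

theorem mdifferentiable_of_mem_maximalAtlas (hψ : ψ ∈ IsManifold.maximalAtlas 𝓘(ℝ, E) ∞ M) :
    ψ.MDifferentiable 𝓘(ℝ, E) 𝓘(ℝ, E) :=
  ⟨(contMDiffOn_of_mem_maximalAtlas hψ).mdifferentiableOn (by simp),
    (contMDiffOn_symm_of_mem_maximalAtlas hψ).mdifferentiableOn (by simp)⟩

section MDifferentiable

variable (hψ : ψ.MDifferentiable 𝓘(ℝ, E) 𝓘(ℝ, E))

include hψ

theorem isInvertible_mfderiv_chart {q : M} (hq : q ∈ ψ.source) :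
    (mfderiv 𝓘(ℝ, E) 𝓘(ℝ, E) ψ q).IsInvertible :=
  ⟨hψ.mfderiv hq, rfl⟩

theorem isInvertible_mfderiv_chart_symm {u : E} (hu : u ∈ ψ.target) :
    (mfderiv 𝓘(ℝ, E) 𝓘(ℝ, E) ψ.symm u).IsInvertible :=
  ⟨hψ.symm.mfderiv (x := u) hu, rfl⟩

theorem mvfderiv_chart_injective {q : M} (hq : q ∈ ψ.source) : Injective (mvfderiv 𝓘(ℝ, E) ψ q) :=
  hψ.mfderiv_injective hq

theorem mvfderiv_chart_surjective {q : M} (hq : q ∈ ψ.source) : Surjective (mvfderiv 𝓘(ℝ, E) ψ q) :=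
  hψ.mfderiv_surjective hq

theorem mfderiv_symm_chartField (X : ∀ x : M, TangentSpace 𝓘(ℝ, E) x) {u : E}
    (hu : u ∈ ψ.target) :
    mfderiv 𝓘(ℝ, E) 𝓘(ℝ, E) ψ.symm u (chartField ψ X u : E) = X (ψ.symm u) :=
  (isInvertible_mfderiv_chart_symm hψ hu).self_apply_inverse _

theorem chartField_apply_symm (X : ∀ x : M, TangentSpace 𝓘(ℝ, E) x) {u : E} (hu : u ∈ ψ.target) :
    chartField ψ X u = mvfderiv 𝓘(ℝ, E) ψ (ψ.symm u) (X (ψ.symm u)) := by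
  rw [← mfderiv_symm_chartField hψ X hu]
  exact (DFunLike.congr_fun (hψ.comp_symm_deriv hu) (chartField ψ X u)).symm

theorem chartField_apply (X : ∀ x : M, TangentSpace 𝓘(ℝ, E) x) {q : M} (hq : q ∈ ψ.source) :
    chartField ψ X (ψ q) = mvfderiv 𝓘(ℝ, E) ψ q (X q) := by
  rw [chartField_apply_symm hψ X (ψ.map_source hq), ψ.left_inv hq]

theorem chartField_apply_eq_zero_iff {X : ∀ x : M, TangentSpace 𝓘(ℝ, E) x} {q : M}
    (hq : q ∈ ψ.source) : chartField ψ X (ψ q) = 0 ↔ X q = 0 := by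
  rw [chartField_apply hψ X hq]
  exact map_eq_zero_iff _ (mvfderiv_chart_injective hψ hq)

theorem chartField_coordinateField (v : E) {u : E} (hu : u ∈ ψ.target) :
    chartField ψ (coordinateField ψ v) u = v := by
  rw [chartField_apply_symm hψ _ hu]
  exact (isInvertible_mfderiv_chart hψ (ψ.map_target hu)).self_apply_inverse _

theorem chartForm_chartField
    (B : ∀ x : M, TangentSpace 𝓘(ℝ, E) x →L[ℝ] TangentSpace 𝓘(ℝ, E) x →L[ℝ] ℝ)
    (X Y : ∀ x : M, TangentSpace 𝓘(ℝ, E) x) {u : E} (hu : u ∈ ψ.target) :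
    chartForm ψ B u (chartField ψ X u) (chartField ψ Y u) =
      B (ψ.symm u) (X (ψ.symm u)) (Y (ψ.symm u)) := by
  rw [← mfderiv_symm_chartField hψ X hu, ← mfderiv_symm_chartField hψ Y hu]
  rfl

theorem chartForm_apply
    (B : ∀ x : M, TangentSpace 𝓘(ℝ, E) x →L[ℝ] TangentSpace 𝓘(ℝ, E) x →L[ℝ] ℝ) {u : E}
    (hu : u ∈ ψ.target) (v w : E) : chartForm ψ B u v w =
      B (ψ.symm u) (coordinateField ψ v (ψ.symm u)) (coordinateField ψ w (ψ.symm u)) := by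
  rw [← chartForm_chartField hψ B _ _ hu, chartField_coordinateField hψ v hu,
    chartField_coordinateField hψ w hu]

theorem chartForm_mvfderiv
    (B : ∀ x : M, TangentSpace 𝓘(ℝ, E) x →L[ℝ] TangentSpace 𝓘(ℝ, E) x →L[ℝ] ℝ) {q : M}
    (hq : q ∈ ψ.source) (v w : TangentSpace 𝓘(ℝ, E) q) :
    chartForm ψ B (ψ q) (mvfderiv 𝓘(ℝ, E) ψ q v) (mvfderiv 𝓘(ℝ, E) ψ q w) = B q v w := by
  obtain ⟨u, hu, rfl⟩ : ∃ u ∈ ψ.target, ψ.symm u = q := ⟨ψ q, ψ.map_source hq, ψ.left_inv hq⟩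
  have h_symm (z : TangentSpace 𝓘(ℝ, E) (ψ.symm u)) :
      mfderiv 𝓘(ℝ, E) 𝓘(ℝ, E) ψ.symm u (mvfderiv 𝓘(ℝ, E) ψ (ψ.symm u) z) = z := by
    obtain ⟨z, rfl⟩ := hψ.symm.mfderiv_surjective (x := u) hu z
    exact congrArg _ (DFunLike.congr_fun (hψ.comp_symm_deriv hu) z)
  rw [ψ.right_inv hu]
  exact congrArg₂ (B (ψ.symm u) · ·) (h_symm v) (h_symm w)

theorem fderiv_comp_symm_chartField (X : ∀ x : M, TangentSpace 𝓘(ℝ, E) x) {f : M → ℝ} {u : E}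
    (hu : u ∈ ψ.target) (hf : MDifferentiableAt 𝓘(ℝ, E) 𝓘(ℝ, ℝ) f (ψ.symm u)) :
    fderiv ℝ (f ∘ ψ.symm) u (chartField ψ X u) =
      mvfderiv 𝓘(ℝ, E) f (ψ.symm u) (X (ψ.symm u)) := by
  rw [← mfderiv_symm_chartField hψ X hu, ← mfderiv_eq_fderiv]
  exact mvfderiv_comp_apply u hf (hψ.mdifferentiableAt_symm hu) (chartField ψ X u : E)

end MDifferentiable

variable [CompleteSpace E] [IsManifold 𝓘(ℝ, E) ∞ M]

theorem contDiffOn_chartField (hψ : ψ ∈ IsManifold.maximalAtlas 𝓘(ℝ, E) ∞ M)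
    {X : ∀ x : M, TangentSpace 𝓘(ℝ, E) x}
    (hX : ContMDiffOn 𝓘(ℝ, E) 𝓘(ℝ, E).tangent ∞
      (fun x ↦ (⟨x, X x⟩ : TangentBundle 𝓘(ℝ, E) M)) ψ.source) :
    ContDiffOn ℝ ∞ (chartField ψ X) ψ.target := fun u hu ↦ by
  have h_pullback := ContMDiffAt.mpullback_vectorField_preimage (m := ∞) (n := ∞) (x₀ := u)
    (hX.contMDiffAt (ψ.open_source.mem_nhds (ψ.map_target hu)))
    (contMDiffAt_symm_of_mem_maximalAtlas hψ hu)
    (isInvertible_mfderiv_chart_symm (mdifferentiable_of_mem_maximalAtlas hψ) hu) (by simp)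
  exact (contMDiffAt_vectorSpace_iff_contDiffAt.1 h_pullback).contDiffWithinAt

theorem contMDiffOn_coordinateField (hψ : ψ ∈ IsManifold.maximalAtlas 𝓘(ℝ, E) ∞ M) (v : E) :
    ContMDiffOn 𝓘(ℝ, E) 𝓘(ℝ, E).tangent ∞
      (fun x ↦ (⟨x, coordinateField ψ v x⟩ : TangentBundle 𝓘(ℝ, E) M)) ψ.source := fun q hq ↦ by
  have h_const : ContMDiffAt 𝓘(ℝ, E) 𝓘(ℝ, E).tangent ∞
      (fun u ↦ (⟨u, v⟩ : TangentBundle 𝓘(ℝ, E) E)) (ψ q) :=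
    contMDiffAt_vectorSpace_iff_contDiffAt.2 contDiffAt_const
  exact (h_const.mpullback_vectorField_preimage (contMDiffAt_of_mem_maximalAtlas hψ hq)
    (isInvertible_mfderiv_chart (mdifferentiable_of_mem_maximalAtlas hψ) hq)
    (by simp)).contMDiffWithinAt

theorem chartField_mlieBracket (hψ : ψ ∈ IsManifold.maximalAtlas 𝓘(ℝ, E) ∞ M)
    {X Y : ∀ x : M, TangentSpace 𝓘(ℝ, E) x} {u : E} (hu : u ∈ ψ.target)
    (hX : ContMDiffAt 𝓘(ℝ, E) 𝓘(ℝ, E).tangent ∞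
      (fun x ↦ (⟨x, X x⟩ : TangentBundle 𝓘(ℝ, E) M)) (ψ.symm u))
    (hY : ContMDiffAt 𝓘(ℝ, E) 𝓘(ℝ, E).tangent ∞
      (fun x ↦ (⟨x, Y x⟩ : TangentBundle 𝓘(ℝ, E) M)) (ψ.symm u)) :
    chartField ψ (mlieBracket 𝓘(ℝ, E) X Y) u =
      lieBracket ℝ (chartField ψ X) (chartField ψ Y) u := by
  have : IsManifold 𝓘(ℝ, E) (minSmoothness ℝ 2) M :=
    IsManifold.of_le (n := ∞) (by simpa using ENat.LEInfty.out)
  have h_pullback := mpullback_mlieBracket (n := ∞) (I := 𝓘(ℝ, E)) (I' := 𝓘(ℝ, E)) (x₀ := u)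
    (f := ψ.symm) (hX.mdifferentiableAt (by simp)) (hY.mdifferentiableAt (by simp))
    (contMDiffAt_symm_of_mem_maximalAtlas hψ hu) (by simpa using ENat.LEInfty.out)
  rw [← mlieBracketWithin_univ (V := mpullback 𝓘(ℝ, E) 𝓘(ℝ, E) ψ.symm X),
    mlieBracketWithin_eq_lieBracketWithin] at h_pullback
  rwa [← lieBracketWithin_univ]

theorem chartField_mlieBracket_coordinateField (hψ : ψ ∈ IsManifold.maximalAtlas 𝓘(ℝ, E) ∞ M)
    {X : ∀ x : M, TangentSpace 𝓘(ℝ, E) x} {u : E} (hu : u ∈ ψ.target)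
    (hX : ContMDiffAt 𝓘(ℝ, E) 𝓘(ℝ, E).tangent ∞
      (fun x ↦ (⟨x, X x⟩ : TangentBundle 𝓘(ℝ, E) M)) (ψ.symm u)) (v : E) :
    chartField ψ (mlieBracket 𝓘(ℝ, E) X (coordinateField ψ v)) u =
      -fderiv ℝ (chartField ψ X) u v := by
  have h_const : chartField ψ (coordinateField ψ v) =ᶠ[𝓝 u] fun _ ↦ v :=
    eventually_of_mem (ψ.open_target.mem_nhds hu) fun _ ↦
      chartField_coordinateField (mdifferentiable_of_mem_maximalAtlas hψ) v
  rw [chartField_mlieBracket hψ hu hX ((contMDiffOn_coordinateField hψ v).contMDiffAt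
    (ψ.open_source.mem_nhds (ψ.map_target hu)))]
  simp [lieBracket, h_const.fderiv_eq, h_const.self_of_nhds]

end Charts

section MetricInCharts

variable {d : ℕ} {M : Type*} [TopologicalSpace M] [ChartedSpace (EuclideanSpace ℝ (Fin d)) M]
  [IsManifold (𝓡 d) ∞ M] {g : LorentzianMetric d M}
  {ψ : OpenPartialHomeomorph M (EuclideanSpace ℝ (Fin d))}

namespace LorentzianMetric

theorem form_injective (g : LorentzianMetric d M) (x : M) : Injective (g.form x) := by
  refine (injective_iff_map_eq_zero _).2 fun v hv ↦ ?_
  obtain ⟨t, -, ht⟩ := g.lorentzian x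
  by_contra hv0
  have h_pos := ht v hv0 (by rw [g.symm, hv, zero_apply])
  rw [hv, zero_apply] at h_pos
  exact h_pos.false

theorem contDiffOn_chartForm (g : LorentzianMetric d M)
    (hψ : ψ ∈ IsManifold.maximalAtlas (𝓡 d) ∞ M) :
    ContDiffOn ℝ ∞ (chartForm ψ g.form) ψ.target := by
  refine contDiffOn_clm_apply.2 fun v ↦ contDiffOn_clm_apply.2 fun w ↦ ?_
  have h_coordinate := (g.contMDiffOn_form (contMDiffOn_coordinateField hψ v)
    (contMDiffOn_coordinateField hψ w)).comp (contMDiffOn_symm_of_mem_maximalAtlas hψ)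
    fun _ ↦ ψ.map_target
  exact (contMDiffOn_iff_contDiffOn.1 h_coordinate).congr fun u hu ↦
    chartForm_apply (mdifferentiable_of_mem_maximalAtlas hψ) g.form hu v w

theorem isPseudoRiemannianOn_chartForm (g : LorentzianMetric d M)
    (hψ : ψ ∈ IsManifold.maximalAtlas (𝓡 d) ∞ M) :
    IsPseudoRiemannianOn (chartForm ψ g.form) ψ.target where
  isOpen := ψ.open_target
  contDiffOn := g.contDiffOn_chartForm hψ
  symm u _ v w := g.symm (ψ.symm u) _ _
  injective u hu := by
    have dψ := mdifferentiable_of_mem_maximalAtlas hψ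
    refine (injective_iff_map_eq_zero _).2 fun v hv ↦ ?_
    obtain ⟨q, hq, rfl⟩ : ∃ q ∈ ψ.source, ψ q = u := ⟨ψ.symm u, ψ.map_target hu, ψ.right_inv hu⟩
    obtain ⟨v, rfl⟩ := mvfderiv_chart_surjective dψ hq v
    have hv0 : v = 0 := (map_eq_zero_iff _ (g.form_injective q)).1 <| ContinuousLinearMap.ext
      fun w ↦ (chartForm_mvfderiv dψ g.form hq v w).symm.trans (by rw [hv]; rfl)
    rw [hv0, map_zero]

theorem IsKilling.isKillingOn_chartField {K : SmoothVectorField d M} (hK : g.IsKilling K)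
    (hψ : ψ ∈ IsManifold.maximalAtlas (𝓡 d) ∞ M) :
    IsKillingOn (chartForm ψ g.form) ψ.target (chartField ψ K) where
  contDiffOn := contDiffOn_chartField hψ K.contMDiff.contMDiffOn
  killing u hu v w := by
    have dψ := mdifferentiable_of_mem_maximalAtlas hψ
    have hv := contMDiffOn_coordinateField hψ v
    have hw := contMDiffOn_coordinateField hψ w
    have dG := (g.isPseudoRiemannianOn_chartForm hψ).differentiableAt hu
    have h_form : (fun y ↦ g.form y (coordinateField ψ v y) (coordinateField ψ w y)) ∘ ψ.symm
        =ᶠ[𝓝 u] fun y ↦ chartForm ψ g.form y v w :=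
      eventually_of_mem (ψ.open_target.mem_nhds hu) fun y hy ↦
        (chartForm_apply dψ g.form hy v w).symm
    have h_deriv := fderiv_comp_symm_chartField dψ K hu (((g.contMDiffOn_form hv hw).contMDiffAt
      (ψ.open_source.mem_nhds (ψ.map_target hu))).mdifferentiableAt (by simp))
    rw [hK ψ.source ψ.open_source _ _ hv hw _ (ψ.map_target hu), h_form.fderiv_eq,
      fderiv_clm_apply₂ dG (differentiableAt_const v) (differentiableAt_const w),
      ← chartForm_chartField dψ g.form _ _ hu, ← chartForm_chartField dψ g.form _ _ hu,
      chartField_mlieBracket_coordinateField hψ hu (K.contMDiff _),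
      chartField_mlieBracket_coordinateField hψ hu (K.contMDiff _),
      chartField_coordinateField dψ v hu, chartField_coordinateField dψ w hu] at h_deriv
    simp only [fderiv_fun_const, Pi.zero_apply, zero_apply, map_zero, add_zero, map_neg,
      neg_apply] at h_deriv
    linarith

theorem exists_nhds_forall_eqOn_zero (g : LorentzianMetric d M)
    (hψ : ψ ∈ IsManifold.maximalAtlas (𝓡 d) ∞ M) {q : M} (hq : q ∈ ψ.source) :
    ∃ O ∈ 𝓝 q, ∀ K : SmoothVectorField d M, g.IsKilling K → ∀ a ∈ O, chartField ψ K (ψ a) = 0 →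
      fderiv ℝ (chartField ψ K) (ψ a) = 0 → ∀ y ∈ O, K y = 0 := by
  obtain ⟨B, hB, h_unique⟩ := (g.isPseudoRiemannianOn_chartForm hψ).exists_mem_nhds_eqOn_zero
    (ψ.map_source hq)
  refine ⟨ψ.source ∩ ψ ⁻¹' B, inter_mem (ψ.open_source.mem_nhds hq)
    ((ψ.continuousAt hq).preimage_mem_nhds hB), fun K hK a ha h₀ h₁ y hy ↦ ?_⟩
  have dψ := mdifferentiable_of_mem_maximalAtlas hψ
  exact (chartField_apply_eq_zero_iff dψ hy.1).1
    (h_unique _ (hK.isKillingOn_chartField hψ) (ψ a) ha.2 h₀ h₁ hy.2)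

theorem IsKilling.eventually_eq_zero_of_frequently_eventually {K : SmoothVectorField d M}
    (hK : g.IsKilling K) {x : M}
    (h : ∃ᶠ y in 𝓝 x, ∀ᶠ z in 𝓝 y, K z = 0) : ∀ᶠ y in 𝓝 x, K y = 0 := by
  have hψ := IsManifold.chart_mem_maximalAtlas (I := 𝓡 d) (n := ∞) x
  set ψ := chartAt (EuclideanSpace ℝ (Fin d)) x
  have hx : x ∈ ψ.source := mem_chart_source _ x
  obtain ⟨O, hO, h_unique⟩ := g.exists_nhds_forall_eqOn_zero hψ hx
  obtain ⟨a, ha, haO, haψ⟩ :=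
    (h.and_eventually (Filter.Eventually.and hO (ψ.open_source.mem_nhds hx))).exists
  have h_field : chartField ψ K =ᶠ[𝓝 (ψ a)] fun _ ↦ 0 := by
    have h_symm : Tendsto ψ.symm (𝓝 (ψ a)) (𝓝 a) := by
      simpa only [ψ.left_inv haψ] using (ψ.continuousAt_symm (ψ.map_source haψ)).tendsto
    filter_upwards [h_symm.eventually ha, ψ.open_target.mem_nhds (ψ.map_source haψ)] with u hu hut
    rw [chartField_apply_symm (mdifferentiable_of_mem_maximalAtlas hψ) K hut, hu, map_zero]
  exact eventually_of_mem hO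
    (h_unique K hK a haO h_field.self_of_nhds (by simp [h_field.fderiv_eq]))

theorem IsKilling.eq_zero_of_chartField_eq_zero [ConnectedSpace M] {K : SmoothVectorField d M}
    (hK : g.IsKilling K) (hψ : ψ ∈ IsManifold.maximalAtlas (𝓡 d) ∞ M) {q : M} (hq : q ∈ ψ.source)
    (h₀ : chartField ψ K (ψ q) = 0) (h₁ : fderiv ℝ (chartField ψ K) (ψ q) = 0) : K = 0 := by
  have h_open : IsOpen {x | ∀ᶠ y in 𝓝 x, K y = 0} := isOpen_setOfPred_eventually_nhds
  have h_closed : IsClosed {x | ∀ᶠ y in 𝓝 x, K y = 0} := isClosed_of_closure_subset fun x hx ↦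
    hK.eventually_eq_zero_of_frequently_eventually (mem_closure_iff_frequently.1 hx)
  obtain ⟨O, hO, h_unique⟩ := g.exists_nhds_forall_eqOn_zero hψ hq
  have hqO : q ∈ {x | ∀ᶠ y in 𝓝 x, K y = 0} :=
    eventually_of_mem hO (h_unique K hK q (mem_of_mem_nhds hO) h₀ h₁)
  have h_univ := IsClopen.eq_univ ⟨h_closed, h_open⟩ ⟨q, hqO⟩
  ext y : 1
  exact (h_univ ▸ mem_univ y : y ∈ {x | ∀ᶠ y in 𝓝 x, K y = 0}).self_of_nhds

theorem exists_eq_smul_of_null (g : LorentzianMetric d M) {x : M} {v w : TangentSpace (𝓡 d) x}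
    (hv : v ≠ 0) (hvv : g.form x v v = 0) (hww : g.form x w w = 0) (hvw : g.form x v w = 0) :
    ∃ c : ℝ, w = c • v := by
  obtain ⟨t, -, ht⟩ := g.lorentzian x
  have htv : g.form x t v ≠ 0 := fun h ↦ (ht v hv h).ne' hvv
  refine ⟨g.form x t w / g.form x t v, ?_⟩
  set z := w - (g.form x t w / g.form x t v) • v with hz
  have htz : g.form x t z = 0 := by
    simp only [hz, map_sub, map_smul, smul_eq_mul]
    field_simp
    ring
  have hzz : g.form x z z = 0 := by
    simp [hz, hvv, hww, hvw, g.symm x w v]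
  by_contra h_ne
  exact (ht z (sub_ne_zero.2 h_ne) htz).ne' hzz

end LorentzianMetric

end MetricInCharts

section LocalImmersions

variable {E E' : Type*} [NormedAddCommGroup E] [NormedSpace ℝ E] [NormedAddCommGroup E']
  [NormedSpace ℝ E'] {M N : Type*} [TopologicalSpace M] [TopologicalSpace N] {ι : N → M}
  {ψ : OpenPartialHomeomorph M E} {φ : OpenPartialHomeomorph N E'} {A : E' →L[ℝ] E} {q : N}

theorem map_comp_nhds_eq_nhdsWithin_range [FiniteDimensional ℝ E'] (hA : Injective A)
    (hqφ : q ∈ φ.source) (h : EqOn (ψ ∘ ι) (A ∘ φ) φ.source) :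
    map (ψ ∘ ι) (𝓝 q) = 𝓝[LinearMap.range A.toLinearMap] (ψ (ι q)) := by
  have h_embedding : Topology.IsEmbedding A :=
    (A.toLinearMap.isClosedEmbedding_of_injective (LinearMap.ker_eq_bot.2 hA)).isEmbedding
  calc map (ψ ∘ ι) (𝓝 q) = map (A ∘ φ) (𝓝 q) :=
        map_congr (eventually_of_mem (φ.open_source.mem_nhds hqφ) h)
    _ = map A (𝓝 (φ q)) := by rw [← Filter.map_map, φ.map_nhds_eq hqφ]
    _ = 𝓝[range A] (A (φ q)) := h_embedding.map_nhds_eq _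
    _ = 𝓝[LinearMap.range A.toLinearMap] (ψ (ι q)) := by
        rw [← show ψ (ι q) = A (φ q) from h hqφ]; rfl

variable [ChartedSpace E M] [ChartedSpace E' N]

theorem exists_charts_eqOn_comp {p : N}
    (hp : Manifold.IsImmersionAt 𝓘(ℝ, E') 𝓘(ℝ, E) ∞ ι p) :
    ∃ φ ∈ IsManifold.maximalAtlas 𝓘(ℝ, E') ∞ N, ∃ ψ ∈ IsManifold.maximalAtlas 𝓘(ℝ, E) ∞ M,
      p ∈ φ.source ∧ MapsTo ι φ.source ψ.source ∧
        ∃ A : E' →L[ℝ] E, Injective A ∧ EqOn (ψ ∘ ι) (A ∘ φ) φ.source := by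
  refine ⟨hp.domChart, hp.domChart_mem_maximalAtlas, hp.codChart, hp.codChart_mem_maximalAtlas,
    hp.mem_domChart_source, hp.source_subset_preimage_source,
    hp.equiv.toContinuousLinearMap.comp (.inl ℝ E' hp.complement),
    hp.equiv.injective.comp LinearMap.inl_injective, fun q hq ↦ ?_⟩
  have hq' : hp.domChart q ∈ (hp.domChart.extend 𝓘(ℝ, E')).target := by
    simpa using hp.domChart.map_source hq
  simpa [hp.domChart.left_inv hq] using hp.writtenInCharts hq'

theorem mvfderiv_chart_mfderiv (hψ : ψ.MDifferentiable 𝓘(ℝ, E) 𝓘(ℝ, E))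
    (hφ : φ.MDifferentiable 𝓘(ℝ, E') 𝓘(ℝ, E'))
    (hι : MDifferentiableAt 𝓘(ℝ, E') 𝓘(ℝ, E) ι q) (hqφ : q ∈ φ.source) (hqψ : ι q ∈ ψ.source)
    (h : EqOn (ψ ∘ ι) (A ∘ φ) φ.source) (z : TangentSpace 𝓘(ℝ, E') q) :
    mvfderiv 𝓘(ℝ, E) ψ (ι q) (mfderiv 𝓘(ℝ, E') 𝓘(ℝ, E) ι q z) =
      A (mvfderiv 𝓘(ℝ, E') φ q z) := by
  have h_eventually : ψ ∘ ι =ᶠ[𝓝 q] A ∘ φ := eventually_of_mem (φ.open_source.mem_nhds hqφ) h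
  have h_left := mfderiv_comp_apply q (hψ.mdifferentiableAt hqψ) hι z
  have h_right := mfderiv_comp_apply (I'' := 𝓘(ℝ, E)) q (A.mdifferentiableAt (x := φ q))
    (hφ.mdifferentiableAt hqφ) z
  rw [A.mfderiv_eq] at h_right
  exact h_left.symm.trans ((DFunLike.congr_fun
    (h_eventually.mfderiv_eq (I := 𝓘(ℝ, E')) (I' := 𝓘(ℝ, E))) z).trans h_right)

theorem mem_range_mfderiv_iff (hψ : ψ.MDifferentiable 𝓘(ℝ, E) 𝓘(ℝ, E))
    (hφ : φ.MDifferentiable 𝓘(ℝ, E') 𝓘(ℝ, E'))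
    (hι : MDifferentiableAt 𝓘(ℝ, E') 𝓘(ℝ, E) ι q) (hqφ : q ∈ φ.source) (hqψ : ι q ∈ ψ.source)
    (h : EqOn (ψ ∘ ι) (A ∘ φ) φ.source) {w : TangentSpace 𝓘(ℝ, E) (ι q)} :
    w ∈ LinearMap.range (mfderiv 𝓘(ℝ, E') 𝓘(ℝ, E) ι q).toLinearMap ↔
      mvfderiv 𝓘(ℝ, E) ψ (ι q) w ∈ LinearMap.range A.toLinearMap := by
  have h_comp := mvfderiv_chart_mfderiv hψ hφ hι hqφ hqψ h
  constructor
  · rintro ⟨z, rfl⟩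
    exact ⟨_, (h_comp z).symm⟩
  · rintro ⟨b, hb⟩
    obtain ⟨z, rfl⟩ := mvfderiv_chart_surjective hφ hqφ b
    exact ⟨z, mvfderiv_chart_injective hψ hqψ ((h_comp z).trans hb)⟩

end LocalImmersions

theorem isCoatom_range_of_injective {K V W : Type*} [DivisionRing K] [AddCommGroup V] [Module K V]
    [AddCommGroup W] [Module K W] [FiniteDimensional K W] {A : V →ₗ[K] W}
    (hA : Injective A) (h : Module.finrank K W = Module.finrank K V + 1) :
    IsCoatom (LinearMap.range A) := by
  rw [← isSimpleModule_iff_isCoatom, isSimpleModule_iff_finrank_eq_one]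
  have h_quotient := (LinearMap.range A).finrank_quotient_add_finrank
  rw [LinearMap.finrank_range_of_inj hA] at h_quotient
  lia

section SliceCharts

variable {n : ℕ} {M : Type*} [TopologicalSpace M]
  [ChartedSpace (EuclideanSpace ℝ (Fin (n + 1))) M]
  {N : Type*} [TopologicalSpace N] [ChartedSpace (EuclideanSpace ℝ (Fin n)) N] {ι : N → M}

/-- A slice chart of the immersed hypersurface `ι` at `p`: a smooth chart of the ambient manifold
that straightens a small piece of the hypersurface around `p` into the hyperplane `V`. Other pieces
of the hypersurface may cross the domain of the chart, so that everything is expressed through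
neighbourhoods of `p` in the hypersurface. -/
structure IsSliceChart (ι : N → M) (p : N)
    (ψ : OpenPartialHomeomorph M (EuclideanSpace ℝ (Fin (n + 1))))
    (V : Submodule ℝ (EuclideanSpace ℝ (Fin (n + 1)))) : Prop where
  mem_maximalAtlas : ψ ∈ IsManifold.maximalAtlas (𝓡 (n + 1)) ∞ M
  isCoatom : IsCoatom V
  map_nhds : map (ψ ∘ ι) (𝓝 p) = 𝓝[V] (ψ (ι p))
  eventually_mem_tangent_iff : ∀ᶠ q in 𝓝 p, ι q ∈ ψ.source ∧
    ∀ w, w ∈ hypersurfaceTangent n ι q ↔ mvfderiv (𝓡 (n + 1)) ψ (ι q) w ∈ V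

theorem IsHypersurface.exists_isSliceChart (hι : IsHypersurface n ι) (p : N) :
    ∃ (ψ : OpenPartialHomeomorph M (EuclideanSpace ℝ (Fin (n + 1)))) (V : Submodule ℝ _),
      IsSliceChart ι p ψ V := by
  obtain ⟨φ, hφ, ψ, hψ, hp, h_maps, A, hA, hA_eq⟩ :=
    exists_charts_eqOn_comp (hι.immersion.isImmersionAt p)
  refine ⟨ψ, LinearMap.range A.toLinearMap, hψ, isCoatom_range_of_injective hA (by simp),
    map_comp_nhds_eq_nhdsWithin_range hA hp hA_eq, ?_⟩
  filter_upwards [φ.open_source.mem_nhds hp] with q hq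
  exact ⟨h_maps hq, fun w ↦ mem_range_mfderiv_iff (mdifferentiable_of_mem_maximalAtlas hψ)
    (mdifferentiable_of_mem_maximalAtlas hφ)
    ((hι.immersion.contMDiff q).mdifferentiableAt (by simp)) hq (h_maps hq) hA_eq⟩

namespace IsSliceChart

variable {p : N} {ψ : OpenPartialHomeomorph M (EuclideanSpace ℝ (Fin (n + 1)))}
  {V : Submodule ℝ (EuclideanSpace ℝ (Fin (n + 1)))} (h : IsSliceChart ι p ψ V)

include h

theorem mem_source : ι p ∈ ψ.source :=
  h.eventually_mem_tangent_iff.self_of_nhds.1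

theorem mem_tangent_iff {w : TangentSpace (𝓡 (n + 1)) (ι p)} :
    w ∈ hypersurfaceTangent n ι p ↔ mvfderiv (𝓡 (n + 1)) ψ (ι p) w ∈ V :=
  h.eventually_mem_tangent_iff.self_of_nhds.2 w

theorem eventually_nhdsWithin {P : EuclideanSpace ℝ (Fin (n + 1)) → Prop}
    (hP : ∀ᶠ q in 𝓝 p, ι q ∈ ψ.source → (∀ w, w ∈ hypersurfaceTangent n ι q ↔
      mvfderiv (𝓡 (n + 1)) ψ (ι q) w ∈ V) → P (ψ (ι q))) :
    ∀ᶠ u in 𝓝[V] (ψ (ι p)), P u := by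
  rw [← h.map_nhds, eventually_map]
  filter_upwards [hP, h.eventually_mem_tangent_iff] with q hq h_slice using hq h_slice.1 h_slice.2

theorem apply_mem : ψ (ι p) ∈ V := by
  have h_ne : (𝓝[V] (ψ (ι p))).NeBot := h.map_nhds ▸ map_neBot
  simpa [V.closed_of_finiteDimensional.closure_eq] using mem_closure_iff_nhdsWithin_neBot.2 h_ne

end IsSliceChart

end SliceCharts

section LieAlgebras

theorem isSolvable_of_forall_mem_derivedSeries_one (R : Type*) {A : Type*} [CommRing R]
    [LieRing A] [LieAlgebra R A] (h : ∀ x ∈ LieAlgebra.derivedSeries R A 1,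
      ∀ y ∈ LieAlgebra.derivedSeries R A 1, ⁅x, y⁆ = 0) : LieAlgebra.IsSolvable A := by
  refine (LieAlgebra.isSolvable_iff R A).2 ⟨2, ?_⟩
  rw [LieAlgebra.derivedSeries_def, LieAlgebra.derivedSeriesOfIdeal_succ,
    LieSubmodule.lie_eq_bot_iff]
  exact h

variable {R A : Type*} [CommRing R] [LieRing A] [LieAlgebra R A] {a : A →ₗ[R] R} {L : A} {c : R}
  (ha : ∀ x y, a ⁅x, y⁆ = a x * a ⁅L, y⁆ - a y * a ⁅L, x⁆)
  (hc : ∀ x, a ⁅L, ⁅L, x⁆⁆ = c * a ⁅L, x⁆)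

include ha hc

theorem apply_lie_lie_eq_mul (x y : A) : a ⁅L, ⁅x, y⁆⁆ = c * a ⁅x, y⁆ := by
  rw [leibniz_lie, map_add, ha ⁅L, x⁆, ha x, ha x y, hc, hc]
  ring

theorem apply_lie_eq_mul_of_mem_derivedSeries_one {w : A}
    (hw : w ∈ LieAlgebra.derivedSeries R A 1) : a ⁅L, w⁆ = c * a w := by
  replace hw : w ∈ Submodule.span R {⁅x, y⁆ | (x : A) (y : A)} :=
    LieAlgebra.coe_derivedSeries_one_eq (R := R) (L := A) ▸ hw
  induction hw using Submodule.span_induction with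
  | mem w hw =>
    obtain ⟨x, y, rfl⟩ := hw
    exact apply_lie_lie_eq_mul ha hc x y
  | zero => simp
  | add w₁ w₂ _ _ h₁ h₂ => rw [lie_add, map_add, map_add, h₁, h₂, mul_add]
  | smul r w _ h => rw [lie_smul, map_smul, map_smul, h, smul_eq_mul, smul_eq_mul, mul_left_comm]

theorem apply_lie_eq_zero_of_mem_derivedSeries_one {x y : A}
    (hx : x ∈ LieAlgebra.derivedSeries R A 1) (hy : y ∈ LieAlgebra.derivedSeries R A 1) :
    a ⁅x, y⁆ = 0 := by
  rw [ha, apply_lie_eq_mul_of_mem_derivedSeries_one ha hc hx,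
    apply_lie_eq_mul_of_mem_derivedSeries_one ha hc hy]
  ring

end LieAlgebras

namespace SmoothVectorField

variable {d : ℕ} {M : Type*} [TopologicalSpace M] [ChartedSpace (EuclideanSpace ℝ (Fin d)) M]
  [IsManifold (𝓡 d) ∞ M]

theorem lie_apply_of_eq_smul {L K₁ K₂ : SmoothVectorField d M} {x : M} {α₁ α₂ : ℝ}
    (h₁ : K₁ x = α₁ • L x) (h₂ : K₂ x = α₂ • L x) :
    ⁅K₁, K₂⁆ x = α₁ • ⁅L, K₂⁆ x - α₂ • ⁅L, K₁⁆ x := by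
  have h_lie : ⁅K₁ - α₁ • L, K₂ - α₂ • L⁆ x = 0 := by
    rw [lie_apply, ← mlieBracketWithin_univ]
    exact mlieBracketWithin_eq_zero_of_eq_zero (by simp [h₁]) (by simp [h₂])
  have h_expand : ⁅K₁ - α₁ • L, K₂ - α₂ • L⁆ = ⁅K₁, K₂⁆ - (α₁ • ⁅L, K₂⁆ - α₂ • ⁅L, K₁⁆) := by
    rw [sub_lie, lie_sub, lie_sub, lie_smul, smul_lie, smul_lie, lie_smul, lie_self,
      ← lie_skew L K₁]
    simp only [smul_neg, smul_zero]
    abel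
  rw [h_expand] at h_lie
  exact sub_eq_zero.1 h_lie

theorem chartField_lie_eqOn {ψ : OpenPartialHomeomorph M (EuclideanSpace ℝ (Fin d))}
    (hψ : ψ ∈ IsManifold.maximalAtlas (𝓡 d) ∞ M) (X Y : SmoothVectorField d M) :
    EqOn (chartField ψ (⁅X, Y⁆ : SmoothVectorField d M))
      (lieBracket ℝ (chartField ψ X) (chartField ψ Y)) ψ.target := fun _ hu ↦
  chartField_mlieBracket hψ hu (X.contMDiff _) (Y.contMDiff _)

theorem isOpen_setOf_ne_zero (X : SmoothVectorField d M) : IsOpen {x | X x ≠ 0} := by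
  refine isOpen_iff_mem_nhds.2 fun x hx ↦ ?_
  have hψ := IsManifold.chart_mem_maximalAtlas (I := 𝓡 d) (n := ∞) x
  set ψ := chartAt (EuclideanSpace ℝ (Fin d)) x
  have hxψ : x ∈ ψ.source := mem_chart_source _ x
  have dψ := mdifferentiable_of_mem_maximalAtlas hψ
  have h_continuous : ContinuousAt (fun y ↦ chartField ψ X (ψ y)) x :=
    ((contDiffOn_chartField hψ X.contMDiff.contMDiffOn).continuousOn.continuousAt
      (ψ.open_target.mem_nhds (ψ.map_source hxψ))).comp (ψ.continuousAt hxψ)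
  filter_upwards [h_continuous.eventually_ne ((chartField_apply_eq_zero_iff dψ hxψ).not.2 hx),
    ψ.open_source.mem_nhds hxψ] with y hy hyψ
  exact (chartField_apply_eq_zero_iff dψ hyψ).not.1 hy

end SmoothVectorField

section NormalKillingFields

variable {n : ℕ} {M : Type*} [TopologicalSpace M]
  [ChartedSpace (EuclideanSpace ℝ (Fin (n + 1))) M] [IsManifold (𝓡 (n + 1)) ∞ M]
  {N : Type*} [TopologicalSpace N] [ChartedSpace (EuclideanSpace ℝ (Fin n)) N] {ι : N → M}
  {g : LorentzianMetric (n + 1) M}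

/-- The vector field `K` is normal to the immersed hypersurface `ι`, that is `g`-orthogonal to all
its tangent spaces. -/
def LorentzianMetric.IsNormalTo (g : LorentzianMetric (n + 1) M) (ι : N → M)
    (K : SmoothVectorField (n + 1) M) : Prop :=
  ∀ p, ∀ w ∈ hypersurfaceTangent n ι p, g.form (ι p) (K (ι p)) w = 0

namespace IsSliceChart

variable {p : N} {ψ : OpenPartialHomeomorph M (EuclideanSpace ℝ (Fin (n + 1)))}
  {V : Submodule ℝ (EuclideanSpace ℝ (Fin (n + 1)))} (h : IsSliceChart ι p ψ V)
  {X : SmoothVectorField (n + 1) M}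

include h

theorem eventually_chartField_mem (hX : ∀ᶠ q in 𝓝 p, X (ι q) ∈ hypersurfaceTangent n ι q) :
    ∀ᶠ u in 𝓝[V] (ψ (ι p)), chartField ψ X u ∈ V :=
  h.eventually_nhdsWithin <| hX.mono fun q hq hqψ h_tangent ↦ by
    rw [chartField_apply (mdifferentiable_of_mem_maximalAtlas h.mem_maximalAtlas) X hqψ]
    exact (h_tangent _).1 hq

theorem eventually_chartField_eq_zero (hX : ∀ᶠ q in 𝓝 p, X (ι q) = 0) :
    ∀ᶠ u in 𝓝[V] (ψ (ι p)), chartField ψ X u = 0 :=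
  h.eventually_nhdsWithin <| hX.mono fun _ hq hqψ _ ↦ (chartField_apply_eq_zero_iff
    (mdifferentiable_of_mem_maximalAtlas h.mem_maximalAtlas) hqψ).2 hq

theorem eventually_chartForm_chartField_self_eq_zero
    (hX : ∀ᶠ q in 𝓝 p, g.form (ι q) (X (ι q)) (X (ι q)) = 0) :
    ∀ᶠ u in 𝓝[V] (ψ (ι p)), chartForm ψ g.form u (chartField ψ X u) (chartField ψ X u) = 0 :=
  h.eventually_nhdsWithin <| hX.mono fun q hq hqψ _ ↦ by
    have dψ := mdifferentiable_of_mem_maximalAtlas h.mem_maximalAtlas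
    rw [chartField_apply dψ X hqψ]
    exact (chartForm_mvfderiv dψ g.form hqψ _ _).trans hq

theorem eventually_chartForm_chartField_eq_zero (hX : g.IsNormalTo ι X) :
    ∀ᶠ u in 𝓝[V] (ψ (ι p)), ∀ v ∈ V, chartForm ψ g.form u (chartField ψ X u) v = 0 :=
  h.eventually_nhdsWithin <| Eventually.of_forall fun q hqψ h_tangent v hv ↦ by
    have dψ := mdifferentiable_of_mem_maximalAtlas h.mem_maximalAtlas
    obtain ⟨w, rfl⟩ := mvfderiv_chart_surjective dψ hqψ v
    rw [chartField_apply dψ X hqψ]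
    exact (chartForm_mvfderiv dψ g.form hqψ _ _).trans (hX q w ((h_tangent w).2 hv))

end IsSliceChart

namespace LorentzianMetric

theorem IsNormalTo.lie (hι : IsHypersurface n ι) {X K : SmoothVectorField (n + 1) M}
    (hX : g.IsKilling X) (hXt : ∀ p, X (ι p) ∈ hypersurfaceTangent n ι p)
    (hK : g.IsNormalTo ι K) : g.IsNormalTo ι ⁅X, K⁆ := fun p w hw ↦ by
  obtain ⟨ψ, V, h⟩ := hι.exists_isSliceChart p
  have hψ := h.mem_maximalAtlas
  have dψ := mdifferentiable_of_mem_maximalAtlas hψ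
  have hu := ψ.map_source h.mem_source
  have h_normal := (hX.isKillingOn_chartField hψ).form_lieBracket_eq_zero_of_mem
    (g.isPseudoRiemannianOn_chartForm hψ) hu
    (differentiableAt_of_contDiffOn (contDiffOn_chartField hψ K.contMDiff.contMDiffOn)
      ψ.open_target hu) V.closed_of_finiteDimensional h.apply_mem
    (h.eventually_chartForm_chartField_eq_zero hK)
    (h.eventually_chartField_mem (Eventually.of_forall hXt))
    (h.mem_tangent_iff.1 hw)
  rw [← chartField_mlieBracket hψ hu (X.contMDiff _) (K.contMDiff _),
    chartField_apply dψ _ h.mem_source] at h_normal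
  exact (chartForm_mvfderiv dψ g.form h.mem_source _ _).symm.trans h_normal

theorem IsKilling.eq_zero_of_eventually_eq_zero [ConnectedSpace M] (hι : IsHypersurface n ι)
    {K : SmoothVectorField (n + 1) M} (hK : g.IsKilling K) {p : N}
    (h₀ : ∀ᶠ q in 𝓝 p, K (ι q) = 0) : K = 0 := by
  obtain ⟨ψ, V, h⟩ := hι.exists_isSliceChart p
  have hψ := h.mem_maximalAtlas
  have h_chart := h.eventually_chartField_eq_zero h₀
  exact hK.eq_zero_of_chartField_eq_zero hψ h.mem_source (h_chart.self_of_nhdsWithin h.apply_mem)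
    ((hK.isKillingOn_chartField hψ).fderiv_eq_zero_of_eventually_eq_zero
      (g.isPseudoRiemannianOn_chartForm hψ) (ψ.map_source h.mem_source) h.isCoatom h.apply_mem
      h_chart)

theorem IsKilling.exists_lie_lie_eq_mul (hι : IsHypersurface n ι)
    {L : SmoothVectorField (n + 1) M} (hL : g.IsKilling L) (hLn : g.IsNormalTo ι L) {p : N}
    (hL_null : ∀ᶠ q in 𝓝 p, g.form (ι q) (L (ι q)) (L (ι q)) = 0) (hLp : L (ι p) ≠ 0) :
    ∃ c : ℝ, ∀ K : SmoothVectorField (n + 1) M, g.IsKilling K → ∀ α β γ : ℝ,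
      K (ι p) = α • L (ι p) → ⁅L, K⁆ (ι p) = β • L (ι p) → ⁅L, ⁅L, K⁆⁆ (ι p) = γ • L (ι p) →
        γ = c * β := by
  obtain ⟨ψ, V, h⟩ := hι.exists_isSliceChart p
  have hψ := h.mem_maximalAtlas
  have dψ := mdifferentiable_of_mem_maximalAtlas hψ
  have hG := g.isPseudoRiemannianOn_chartForm hψ
  have hLψ := hL.isKillingOn_chartField hψ
  have hu := ψ.map_source h.mem_source
  have hL0 : chartField ψ L (ψ (ι p)) ≠ 0 :=
    (chartField_apply_eq_zero_iff dψ h.mem_source).not.2 hLp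
  obtain ⟨κ, hκ⟩ := hG.exists_surfaceGravity hu
    (differentiableAt_of_contDiffOn hLψ.contDiffOn ψ.open_target hu) hL0 h.isCoatom h.apply_mem
    ((h.eventually_chartForm_chartField_eq_zero hLn).self_of_nhdsWithin h.apply_mem)
    (h.eventually_chartForm_chartField_self_eq_zero hL_null)
  have h_smul {X : SmoothVectorField (n + 1) M} {a : ℝ} (hX : X (ι p) = a • L (ι p)) :
      chartField ψ X (ψ (ι p)) = a • chartField ψ L (ψ (ι p)) := by
    rw [chartField_apply dψ X h.mem_source, chartField_apply dψ L h.mem_source, hX]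
    exact map_smul _ a _
  refine ⟨-κ, fun K hK α β γ hα hβ hγ ↦ ?_⟩
  have hLK : g.IsKilling ⁅L, K⁆ := g.killingAlgebra.lie_mem hL hK
  have h_lie := SmoothVectorField.chartField_lie_eqOn hψ L K
  have h_lie_lie : lieBracket ℝ (chartField ψ L) (lieBracket ℝ (chartField ψ L) (chartField ψ K))
      (ψ (ι p)) = γ • chartField ψ L (ψ (ι p)) :=
    (EventuallyEq.lieBracket_vectorField_eq (𝕜 := ℝ) (.refl _ _)
      (h_lie.symm.eventuallyEq_of_mem (ψ.open_target.mem_nhds hu))).trans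
      ((SmoothVectorField.chartField_lie_eqOn hψ L ⁅L, K⁆ hu).symm.trans (h_smul hγ))
  exact hLψ.eq_neg_mul_of_apply_eq_smul (hK.isKillingOn_chartField hψ)
    ((hLK.isKillingOn_chartField hψ).congr ψ.open_target h_lie.symm) hG hu hL0 hκ (h_smul hα)
    ((h_lie hu).symm.trans (h_smul hβ)) h_lie_lie

theorem IsNullHypersurface.isNormalTo_of_null (hN : g.IsNullHypersurface ι)
    {K : SmoothVectorField (n + 1) M} (hKt : ∀ p, K (ι p) ∈ hypersurfaceTangent n ι p)
    (hK : ∀ p, g.form (ι p) (K (ι p)) (K (ι p)) = 0) : g.IsNormalTo ι K := fun p w hw ↦ by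
  obtain ⟨v, hv, hv0, hvn⟩ := hN.2 p
  obtain ⟨c, hc⟩ := g.exists_eq_smul_of_null hv0 (hvn v hv) (hK p) (hvn _ (hKt p))
  simp [hc, hvn w hw]

theorem IsNormalTo.isGenerator [ConnectedSpace M] (hι : IsHypersurface n ι)
    {K : SmoothVectorField (n + 1) M} (hKn : g.IsNormalTo ι K) (hK : g.IsKilling K)
    (hKt : ∀ p, K (ι p) ∈ hypersurfaceTangent n ι p) (hK0 : K ≠ 0) : g.IsGenerator ι K := by
  refine ⟨fun p ↦ hKn p _ (hKt p), {p | K (ι p) ≠ 0},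
    K.isOpen_setOf_ne_zero.preimage hι.immersion.contMDiff.continuous, fun p ↦ ?_,
    fun p hp ↦ ⟨hKt p, hp⟩⟩
  refine mem_closure_iff_frequently.2 fun h ↦ hK0 (hK.eq_zero_of_eventually_eq_zero hι (p := p) ?_)
  simpa using h

theorem IsGenerator.exists_ne_zero [Nonempty N] {K : SmoothVectorField (n + 1) M}
    (hK : g.IsGenerator ι K) : ∃ p, K (ι p) ≠ 0 := by
  obtain ⟨-, V, -, hV_dense, hV⟩ := hK
  obtain ⟨p, hp⟩ := hV_dense.nonempty
  exact ⟨p, (hV p hp).2⟩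

theorem IsKillingHorizon.exists_isGenerator (hH : g.IsKillingHorizon ι) :
    ∃ K ∈ g.killingAlgebra, g.IsGenerator ι K := by
  obtain ⟨-, K, hK, hKH⟩ := hH
  exact ⟨K, hK, fun p ↦ (hKH p).1, univ, isOpen_univ, dense_univ, fun p _ ↦ (hKH p).2⟩

/-- The ideal of all Killing fields that are normal to a hypersurface which is invariant under the
Killing algebra. -/
def normalIdeal (g : LorentzianMetric (n + 1) M) (hι : IsHypersurface n ι)
    (hinv : g.IsKillingInvariant ι) : LieIdeal ℝ g.killingAlgebra where
  carrier := {K | g.IsNormalTo ι K}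
  zero_mem' p w _ := by simp
  add_mem' hK hL p w hw := by simp [hK p w hw, hL p w hw]
  smul_mem' c K hK p w hw := by simp [hK p w hw]
  lie_mem {X _} hK := hK.lie hι X.2 (hinv X X.2)

theorem coe_normalIdeal [ConnectedSpace M] (hN : g.IsNullHypersurface ι)
    (hinv : g.IsKillingInvariant ι) :
    (g.normalIdeal hN.1 hinv : Set g.killingAlgebra) = g.generators ι := by
  ext K
  constructor
  · intro hK
    refine or_iff_not_imp_right.2 fun hK0 ↦ IsNormalTo.isGenerator hN.1 hK K.2 (hinv K K.2) ?_
    simpa using hK0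
  · rintro (hK | rfl)
    · exact hN.isNormalTo_of_null (hinv K K.2) hK.1
    · exact zero_mem (g.normalIdeal hN.1 hinv)

section NormalIdeal

variable (hι : IsHypersurface n ι) (hinv : g.IsKillingInvariant ι) {L : g.normalIdeal hι hinv}
  {p : N}

theorem exists_linearMap_eq_smul (hLp : L.1.1 (ι p) ≠ 0) :
    ∃ a : g.normalIdeal hι hinv →ₗ[ℝ] ℝ, ∀ K, K.1.1 (ι p) = a K • L.1.1 (ι p) := by
  obtain ⟨φ, hφ⟩ := Module.Projective.exists_dual_eq_one ℝ hLp
  refine ⟨{ toFun K := φ (K.1.1 (ι p)), map_add' _ _ := by simp, map_smul' _ _ := by simp },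
    fun K ↦ ?_⟩
  have h_tangent (X : g.killingAlgebra) := hinv X X.2 p
  obtain ⟨c, hc⟩ := g.exists_eq_smul_of_null hLp (L.2 p _ (h_tangent L)) (K.2 p _ (h_tangent K))
    (L.2 p _ (h_tangent K))
  simp [hc, hφ]

theorem lie_apply_eq_zero_of_mem_derivedSeries_one (hLp : L.1.1 (ι p) ≠ 0)
    {x y : g.normalIdeal hι hinv}
    (hx : x ∈ LieAlgebra.derivedSeries ℝ (g.normalIdeal hι hinv) 1)
    (hy : y ∈ LieAlgebra.derivedSeries ℝ (g.normalIdeal hι hinv) 1) :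
    ⁅x, y⁆.1.1 (ι p) = 0 := by
  obtain ⟨a, ha⟩ := exists_linearMap_eq_smul hι hinv hLp
  obtain ⟨c, hc⟩ := IsKilling.exists_lie_lie_eq_mul hι L.1.2 L.2
    (Eventually.of_forall fun q ↦ L.2 q _ (hinv L.1 L.1.2 q)) hLp
  have h_lie (z w) : a ⁅z, w⁆ = a z * a ⁅L, w⁆ - a w * a ⁅L, z⁆ := by
    refine smul_left_injective ℝ hLp ?_
    calc a ⁅z, w⁆ • L.1.1 (ι p) = ⁅z.1.1, w.1.1⁆ (ι p) := (ha ⁅z, w⁆).symm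
      _ = a z • ⁅L.1.1, w.1.1⁆ (ι p) - a w • ⁅L.1.1, z.1.1⁆ (ι p) :=
        SmoothVectorField.lie_apply_of_eq_smul (ha z) (ha w)
      _ = a z • a ⁅L, w⁆ • L.1.1 (ι p) - a w • a ⁅L, z⁆ • L.1.1 (ι p) := by
        rw [← ha ⁅L, w⁆, ← ha ⁅L, z⁆]; rfl
      _ = (a z * a ⁅L, w⁆ - a w * a ⁅L, z⁆) • L.1.1 (ι p) := by
        rw [sub_smul, mul_smul, mul_smul]
  rw [ha, apply_lie_eq_zero_of_mem_derivedSeries_one h_lie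
    (fun z ↦ hc z.1.1 z.1.2 _ _ _ (ha z) (ha ⁅L, z⁆) (ha ⁅L, ⁅L, z⁆⁆)) hx hy, zero_smul]

theorem isSolvable_normalIdeal [ConnectedSpace M] :
    LieAlgebra.IsSolvable (g.normalIdeal hι hinv) := by
  refine isSolvable_of_forall_mem_derivedSeries_one ℝ fun x hx y hy ↦ ?_
  obtain ⟨p₀⟩ := hι.nonempty
  have h_vanish (p : N) : ⁅x, y⁆.1.1 (ι p) = 0 := by
    by_contra h_ne
    exact h_ne (lie_apply_eq_zero_of_mem_derivedSeries_one hι hinv h_ne hx hy)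
  exact Subtype.ext <| Subtype.ext <| ⁅x, y⁆.1.2.eq_zero_of_eventually_eq_zero hι
    (Eventually.of_forall h_vanish : ∀ᶠ q in 𝓝 p₀, _)

end NormalIdeal

end LorentzianMetric

end NormalKillingFields

theorem mainTheorem6_general {n : ℕ} {M : Type*} [TopologicalSpace M] [ConnectedSpace M]
    [ChartedSpace (EuclideanSpace ℝ (Fin (n + 1))) M] [IsManifold (𝓡 (n + 1)) ∞ M]
    (g : LorentzianMetric (n + 1) M)
    {N : Type*} [TopologicalSpace N] [ChartedSpace (EuclideanSpace ℝ (Fin n)) N] (ι : N → M)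
    (hN : g.IsNullHypersurface ι) (hinv : g.IsKillingInvariant ι) :
    (∃ 𝔞 : LieIdeal ℝ g.killingAlgebra,
      (𝔞 : Set g.killingAlgebra) = g.generators ι ∧
        𝔞 ≤ LieAlgebra.radical ℝ g.killingAlgebra) ∧
    ((∃ K ∈ g.killingAlgebra, g.IsGenerator ι K) →
      LieAlgebra.radical ℝ g.killingAlgebra ≠ ⊥) := by
  have h_coe := LorentzianMetric.coe_normalIdeal hN hinv
  have h_le : g.normalIdeal hN.1 hinv ≤ LieAlgebra.radical ℝ g.killingAlgebra :=
    le_sSup (LorentzianMetric.isSolvable_normalIdeal hN.1 hinv)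
  refine ⟨⟨_, h_coe, h_le⟩, fun ⟨K, hK, hK_gen⟩ h_bot ↦ ?_⟩
  have h_mem : (⟨K, hK⟩ : g.killingAlgebra) ∈ g.normalIdeal hN.1 hinv := by
    rw [← SetLike.mem_coe, h_coe]
    exact .inl hK_gen
  have hK0 : (⟨K, hK⟩ : g.killingAlgebra) = 0 := by simpa [h_bot] using h_le h_mem
  have := hN.1.nonempty
  obtain ⟨p, hp⟩ := hK_gen.exists_ne_zero
  exact hp (congrArg (fun X : g.killingAlgebra ↦ X.1 (ι p)) hK0)

end

theorem mainTheorem6 {n : ℕ} {M : Type*} [TopologicalSpace M] [T2Space M]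
    [SecondCountableTopology M] [ConnectedSpace M]
    [ChartedSpace (EuclideanSpace ℝ (Fin (n + 1))) M] [IsManifold (𝓡 (n + 1)) ∞ M]
    (g : LorentzianMetric (n + 1) M)
    {N : Type*} [TopologicalSpace N] [ChartedSpace (EuclideanSpace ℝ (Fin n)) N]
    [IsManifold (𝓡 n) ∞ N] (ι : N → M)
    (hH : g.IsKillingHorizon ι) (hinv : g.IsKillingInvariant ι) :
    (∃ 𝔞 : LieIdeal ℝ g.killingAlgebra,
      (𝔞 : Set g.killingAlgebra) = g.generators ι ∧
        𝔞 ≤ LieAlgebra.radical ℝ g.killingAlgebra) ∧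
    LieAlgebra.radical ℝ g.killingAlgebra ≠ ⊥ := by
  obtain ⟨h_ideal, h_radical⟩ := mainTheorem6_general g ι hH.1 hinv
  exact ⟨h_ideal, h_radical hH.exists_isGenerator⟩
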